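/- Let $0<T_{\min}<T_{\max}$, $A\in\mathbb R^{n\times n}$, $B\in\mathbb R^{n\times p}$, $C_J\in\mathbb R^{q\times n}$, put $\hat A=\begin{pmatrix}A&B\\0&0\end{pmatrix}\in\mathbb R^{(n+p)\times(n+p)}$, and let $V_J$ be a matrix whose columns form a basis of $\ker(C_J)$. For sampling instants $0=t_0<t_1<\dots$ with $t_k-t_{k-1}\in[T_{\min},T_{\max}]$ and the clock $\theta(t)=t-t_k$ on $[t_k,t_{k+1})$, consider the sampled-data system $\dot x=Ax+Bu$, $y_J(k)=C_Jx(t_k^-)$, $u$ constant on each $[t_k,t_{k+1})$, rewritten as the impulsive system with state $z=(x,u)$ $$\begin{pmatrix}\dot z(t)\\ y(t)\end{pmatrix}=\begin{pmatrix}\hat A&0\\0&0\end{pmatrix}\begin{pmatrix}z(t)\\ \hat u(t)\end{pmatrix},\qquad \begin{pmatrix}z(t_k)\\ y_J(k)\end{pmatrix}=\begin{pmatrix}\hat A_J&\hat B_J\\ \hat C_J&0\end{pmatrix}\begin{pmatrix}z(t_k^-)\\ u_J(k)\end{pmatrix},$$ $$\hat A_J=\begin{pmatrix}I&0\\0&0\end{pmatrix},\quad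 \hat B_J=\begin{pmatrix}0\\ I\end{pmatrix},\quad \hat C_J=\begin{pmatrix}C_J&0\end{pmatrix}$$ (with $\hat u$ and $y$ of any dimensions). A controller of order $n_c\in\mathbb N_0$ is $$\begin{pmatrix}\dot x_c(t)\\ \hat u(t)\end{pmatrix}=\begin{pmatrix}A^c&B^c\\C^c&D^c\end{pmatrix}(\theta(t))\begin{pmatrix}x_c(t)\\ y(t)\end{pmatrix},\qquad \begin{pmatrix}x_c(t_k)\\ u_J(k)\end{pmatrix}=\begin{pmatrix}A_J^c&B_J^c\\C_J^c&D_J^c\end{pmatrix}(\theta(t_k^-))\begin{pmatrix}x_c(t_k^-)\\ y_J(k)\end{pmatrix}$$ with the first four maps continuous on $[0,T_{\max}]$ and the last four continuous on $[T_{\min},T_{\max}]$. The closed loop with state $(z,x_c)$ has the flow matrix $\mathcal A(\tau)=\begin{pmatrix}\hat A&0\\0&A^c(\tau)\end{pmatrix}$ and the jump matrix $\mathcal A_J(\tau)=\begin{pmatrix}\hat A_J+\hat B_JD_J^c(\tau)\hat C_J&\hat B_JC_J^c(\tau)\\ B_J^c(\tau)\hat C_J&A_J^c(\tau)\end{pmatrix}$.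 Then the following are equivalent. (i) There are a controller of this form, of some order $n_c$, and a continuously differentiable symmetric-matrix-valued $\mathcal X$ on $[0,T_{\max}]$ with $\mathcal X(\tau)\succ0$ and $$\begin{pmatrix}I\\ \mathcal A(\tau)\end{pmatrix}^T\begin{pmatrix}\dot{\mathcal X}(\tau)&\mathcal X(\tau)\\ \mathcal X(\tau)&0\end{pmatrix}\begin{pmatrix}I\\ \mathcal A(\tau)\end{pmatrix}\prec0\quad\text{for all }\tau\in[0,T_{\max}],$$ $$\begin{pmatrix}I\\ \mathcal A_J(\tau)\end{pmatrix}^T\begin{pmatrix}-\mathcal X(\tau)&0\\0&\mathcal X(0)\end{pmatrix}\begin{pmatrix}I\\ \mathcal A_J(\tau)\end{pmatrix}\prec0\quad\text{for all }\tau\in[T_{\min},T_{\max}].$$ (ii) There are continuously differentiable $X,Y$ on $[0,T_{\max}]$ with values in the symmetric $(n+p)\times(n+p)$ matrices and with upper left $n\times n$ blocks $X_1,Y_1$ such that $$\begin{pmatrix}Y(\tau)&I\\I&X(\tau)\end{pmatrix}\succ0,\qquad \begin{pmatrix}I\\ \hat A\end{pmatrix}^T\begin{pmatrix}\dot X(\tau)&X(\tau)\\X(\tau)&0\end{pmatrix}\begin{pmatrix}I\\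 \hat A\end{pmatrix}\prec0,\qquad \begin{pmatrix}-\hat A^T\\I\end{pmatrix}^T\begin{pmatrix}0&Y(\tau)\\Y(\tau)&\dot Y(\tau)\end{pmatrix}\begin{pmatrix}-\hat A^T\\I\end{pmatrix}\succ0$$ for all $\tau\in[0,T_{\max}]$, and $$\begin{pmatrix}V_J&0\\0&I\end{pmatrix}^T\left(\begin{pmatrix}X_1(0)&0\\0&0\end{pmatrix}-X(\tau)\right)\begin{pmatrix}V_J&0\\0&I\end{pmatrix}\prec0,\qquad Y_1(0)-Y_1(\tau)\succ0$$ for all $\tau\in[T_{\min},T_{\max}]$. -/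

import Mathlib

open Set

namespace ImpulsiveDesign

open Matrix

/-- Negative definiteness `M ≺ 0` of a real matrix (symmetry included). -/
def NegDef {n : Type*} (M : Matrix n n ℝ) : Prop := (-M).PosDef

/-- `X ∈ C¹([0, T], 𝕊ⁿ)`: symmetric-matrix-valued and continuously differentiable on `[0, T]`
(equivalently, all entries are). -/
def IsC1Sym {n : Type*} (T : ℝ) (X : ℝ → Matrix n n ℝ) : Prop :=
  (∀ τ ∈ Icc 0 T, (X τ).IsSymm) ∧ ∀ i j, ContDiffOn ℝ 1 (fun t => X t i j) (Icc 0 T)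

/-- The derivative of a matrix function on `[0, T]`, taken entrywise (one-sided at the end points
`0` and `T`). -/
noncomputable def mderiv {n m : Type*} (T : ℝ) (X : ℝ → Matrix n m ℝ) (τ : ℝ) : Matrix n m ℝ :=
  Matrix.of fun i j => derivWithin (fun t => X t i j) (Icc 0 T) τ

/-- The columns of `V` form a basis of `ker C`. -/
def IsKerBasis {q n r : Type*} [Fintype n] (C : Matrix q n ℝ) (V : Matrix n r ℝ) : Prop :=
  LinearIndependent ℝ V.col ∧ Submodule.span ℝ (range V.col) = LinearMap.ker C.mulVecLin

/-- The flow form `(I; A)ᵀ [[X', X], [X, 0]] (I; A)`, where `X'` stands for the derivative. -/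
def flowForm {n : Type*} [Fintype n] [DecidableEq n] (A X' X : Matrix n n ℝ) : Matrix n n ℝ :=
  (fromRows (1 : Matrix n n ℝ) A)ᵀ * fromBlocks X' X X 0 * fromRows (1 : Matrix n n ℝ) A

/-- The dual flow form `(-Aᵀ; I)ᵀ [[0, Y], [Y, Y']] (-Aᵀ; I)`. -/
def dualFlowForm {n : Type*} [Fintype n] [DecidableEq n] (A Y' Y : Matrix n n ℝ) :
    Matrix n n ℝ :=
  (fromRows (-Aᵀ) (1 : Matrix n n ℝ))ᵀ * fromBlocks 0 Y Y Y' * fromRows (-Aᵀ) (1 : Matrix n n ℝ)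

/-- The jump form `(I; A_J)ᵀ [[-X, 0], [0, X₀]] (I; A_J)`. -/
def jumpForm {n : Type*} [Fintype n] [DecidableEq n] (AJ X X₀ : Matrix n n ℝ) : Matrix n n ℝ :=
  (fromRows (1 : Matrix n n ℝ) AJ)ᵀ * fromBlocks (-X) 0 0 X₀ * fromRows (1 : Matrix n n ℝ) AJ

/-- `X` satisfies the clock-dependent stability LMIs for the impulsive system
`x'(t) = A(θ(t)) x(t)`, `x(t_k) = A_J(θ(t_k⁻)) x(t_k⁻)` under the range dwell-time condition
`t_k - t_{k-1} ∈ [Tmin, Tmax]`. -/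
structure IsCertificate {n : Type*} [Fintype n] [DecidableEq n] (Tmin Tmax : ℝ)
    (A AJ : ℝ → Matrix n n ℝ) (X : ℝ → Matrix n n ℝ) : Prop where
  c1 : IsC1Sym Tmax X
  pos : ∀ τ ∈ Icc 0 Tmax, (X τ).PosDef
  flow : ∀ τ ∈ Icc 0 Tmax, NegDef (flowForm (A τ) (mderiv Tmax X τ) (X τ))
  jump : ∀ τ ∈ Icc Tmin Tmax, NegDef (jumpForm (AJ τ) (X τ) (X 0))

/-- Impulsive open-loop system with state index `n`, flow input/output indices `m`, `l` and jump
input/output indices `mJ`, `lJ`: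
`x' = A x + B u`, `y = C x`, and `x(t_k) = A_J x(t_k⁻) + B_J u_J(k)`, `y_J(k) = C_J x(t_k⁻)`. -/
structure Plant (n m l mJ lJ : Type*) where
  A : Matrix n n ℝ
  B : Matrix n m ℝ
  C : Matrix l n ℝ
  AJ : Matrix n n ℝ
  BJ : Matrix n mJ ℝ
  CJ : Matrix lJ n ℝ

/-- Clock-dependent dynamic output-feedback controller with state index `c`, driven by `(y, y_J)`
and producing `(u, u_J)`:
`x_c' = A(θ) x_c + B(θ) y`, `u = C(θ) x_c + D(θ) y` along the flow, and
`x_c(t_k) = A_J(θ) x_c(t_k⁻) + B_J(θ) y_J(k)`, `u_J(k) = C_J(θ) x_c(t_k⁻) + D_J(θ) y_J(k)`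
with `θ = θ(t_k⁻)` at jumps. Only the values of the flow maps on `[0, Tmax]` and of the jump maps
on `[Tmin, Tmax]` matter. -/
structure Controller (c m l mJ lJ : Type*) where
  A : ℝ → Matrix c c ℝ
  B : ℝ → Matrix c l ℝ
  C : ℝ → Matrix m c ℝ
  D : ℝ → Matrix m l ℝ
  AJ : ℝ → Matrix c c ℝ
  BJ : ℝ → Matrix c lJ ℝ
  CJ : ℝ → Matrix mJ c ℝ
  DJ : ℝ → Matrix mJ lJ ℝ

/-- The controller maps are continuous, the flow maps on `[0, Tmax]` and the jump maps on
`[Tmin, Tmax]`. -/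
structure Controller.IsContinuous {c m l mJ lJ : Type*} (Tmin Tmax : ℝ)
    (K : Controller c m l mJ lJ) : Prop where
  A : ContinuousOn K.A (Icc 0 Tmax)
  B : ContinuousOn K.B (Icc 0 Tmax)
  C : ContinuousOn K.C (Icc 0 Tmax)
  D : ContinuousOn K.D (Icc 0 Tmax)
  AJ : ContinuousOn K.AJ (Icc Tmin Tmax)
  BJ : ContinuousOn K.BJ (Icc Tmin Tmax)
  CJ : ContinuousOn K.CJ (Icc Tmin Tmax)
  DJ : ContinuousOn K.DJ (Icc Tmin Tmax)

section ClosedLoop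

variable {n m l mJ lJ c : Type*} [Fintype n] [Fintype m] [Fintype l] [Fintype mJ] [Fintype lJ]

/-- Flow matrix of the closed loop with state `(x, x_c)`. -/
def clFlow (P : Plant n m l mJ lJ) (K : Controller c m l mJ lJ) (τ : ℝ) :
    Matrix (n ⊕ c) (n ⊕ c) ℝ :=
  fromBlocks (P.A + P.B * K.D τ * P.C) (P.B * K.C τ) (K.B τ * P.C) (K.A τ)

/-- Jump matrix of the closed loop with state `(x, x_c)`. -/
def clJump (P : Plant n m l mJ lJ) (K : Controller c m l mJ lJ) (τ : ℝ) :
    Matrix (n ⊕ c) (n ⊕ c) ℝ :=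
  fromBlocks (P.AJ + P.BJ * K.DJ τ * P.CJ) (P.BJ * K.CJ τ) (K.BJ τ * P.CJ) (K.AJ τ)

end ClosedLoop

/-- There is a controller, of some finite order `nc`, with continuous maps for which the stability
LMIs of the closed loop are feasible. -/
def ExistsCertifiedController {n m l mJ lJ : Type*} [Fintype n] [DecidableEq n] [Fintype m]
    [Fintype l] [Fintype mJ] [Fintype lJ] (Tmin Tmax : ℝ) (P : Plant n m l mJ lJ) : Prop :=
  ∃ (nc : ℕ) (K : Controller (Fin nc) m l mJ lJ), K.IsContinuous Tmin Tmax ∧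
    ∃ X : ℝ → Matrix (n ⊕ Fin nc) (n ⊕ Fin nc) ℝ,
      IsCertificate Tmin Tmax (clFlow P K) (clJump P K) X

/-- The matrix `Â = [[A, B], [0, 0]]`. -/
def hatA {n p : Type*} (A : Matrix n n ℝ) (B : Matrix n p ℝ) : Matrix (n ⊕ p) (n ⊕ p) ℝ :=
  fromBlocks A B 0 0

/-- The sampled-data system `x' = A x + B u`, `y_J(k) = C_J x(t_k⁻)`, with `u` constant between the
sampling instants, as an impulsive system with state `(x, u)`: the flow is `Â`, the flow input
and output are void (zero matrices), and at jumps `x(t_k) = x(t_k⁻)`, `u(t_k) = u_J(k)`. -/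
def sampledDataPlant {n p q : Type*} [DecidableEq n] [DecidableEq p] (m l : Type*)
    (A : Matrix n n ℝ) (B : Matrix n p ℝ) (CJ : Matrix q n ℝ) : Plant (n ⊕ p) m l p q where
  A := hatA A B
  B := 0
  C := 0
  AJ := fromBlocks 1 0 0 0
  BJ := fromRows 0 1
  CJ := fromCols CJ 0

end ImpulsiveDesign

open ImpulsiveDesign Matrix

/-!
At a fixed clock value each closed-loop inequality asserts that `Ψ + Qᵀ Θ P + (Qᵀ Θ P)ᵀ ≻ 0`, where
`Θ` collects the controller gains, so by the projection lemma suitable gains exist iff `Ψ` is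
positive definite on `ker P` and on `ker Q`. The admissible gains form a convex set, and a gain
stays admissible for nearby clock values, so a partition of unity glues pointwise gains to
continuous ones. A dynamic controller is a static gain for the plant augmented by an integrator;
the kernels of the augmented plant only see the plant blocks `X` of the closed-loop Lyapunov matrix
and `Y` of its inverse. Conversely, `Y ≻ 0` and `X ≻ Y⁻¹` are such blocks of the positive definite
matrix `[[X, X - Y⁻¹], [X - Y⁻¹, X - Y⁻¹]]` and of its inverse.
-/

namespace ImpulsiveDesign

section PosDef

variable {ι κ α : Type*}

theorem isSymm_of_posDef {S : Matrix ι ι ℝ} (hS : S.PosDef) : S.IsSymm :=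
  isHermitian_iff_isSymm.mp hS.isHermitian

theorem posDef_submatrix_equiv {S : Matrix κ κ ℝ} (e : ι ≃ κ) :
    (S.submatrix e e).PosDef ↔ S.PosDef :=
  ⟨fun h => by simpa using h.submatrix e.symm.injective, fun h => h.submatrix e.injective⟩

theorem posDef_transpose_mul_mul_same [Fintype ι] [Fintype κ] {S : Matrix ι ι ℝ} (hS : S.PosDef)
    {G : Matrix ι κ ℝ} (hG : Function.Injective G.mulVec) : (Gᵀ * S * G).PosDef := by
  simpa only [conjTranspose_eq_transpose_of_trivial] using hS.conjTranspose_mul_mul_same hG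

theorem dotProduct_transpose_mul_mul_same_mulVec [Fintype ι] [Fintype κ] (S : Matrix ι ι ℝ)
    (G : Matrix ι κ ℝ) (x : κ → ℝ) : x ⬝ᵥ (Gᵀ * S * G) *ᵥ x = G *ᵥ x ⬝ᵥ S *ᵥ G *ᵥ x := by
  rw [← mulVec_mulVec, ← mulVec_mulVec, dotProduct_mulVec, vecMul_transpose]

theorem posDef_add_transpose_mul_mul_same [Fintype ι] [Fintype κ] [Fintype α]
    {S : Matrix ι ι ℝ} {R : Matrix κ κ ℝ} (hS : S.PosDef) (hR : R.PosDef) {G : Matrix ι α ℝ}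
    {H : Matrix κ α ℝ} (h : ∀ x, G *ᵥ x = 0 → H *ᵥ x = 0 → x = 0) :
    (Gᵀ * S * G + Hᵀ * R * H).PosDef := by
  have hG := hS.posSemidef.conjTranspose_mul_mul_same G
  have hH := hR.posSemidef.conjTranspose_mul_mul_same H
  refine .of_dotProduct_mulVec_pos (hG.add hH).isHermitian fun x hx => ?_
  rw [star_trivial, add_mulVec, dotProduct_add, dotProduct_transpose_mul_mul_same_mulVec,
    dotProduct_transpose_mul_mul_same_mulVec]
  by_cases hGx : G *ᵥ x = 0
  · exact add_pos_of_nonneg_of_pos (hS.posSemidef.dotProduct_mulVec_nonneg _)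
      (hR.dotProduct_mulVec_pos fun hHx => hx (h x hGx hHx))
  · exact add_pos_of_pos_of_nonneg (hS.dotProduct_mulVec_pos hGx)
      (hR.posSemidef.dotProduct_mulVec_nonneg _)

theorem posDef_fromBlocks_iff₂₂ [Finite ι] [Fintype κ] [DecidableEq κ] {S : Matrix ι ι ℝ}
    {L : Matrix ι κ ℝ} {D : Matrix κ κ ℝ} (hD : D.PosDef) :
    (fromBlocks S L Lᵀ D).PosDef ↔ (S - L * D⁻¹ * Lᵀ).PosDef := by
  classical
  let _ := Fintype.ofFinite ι
  let _ : Invertible D := hD.isUnit.invertible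
  have h_semidef := hD.fromBlocks₂₂ S L
  have h_unit := isUnit_fromBlocks_iff_of_invertible₂₂ (A := S) (B := L) (C := Lᵀ) (D := D)
  rw [conjTranspose_eq_transpose_of_trivial] at h_semidef
  rw [invOf_eq_nonsing_inv] at h_unit
  constructor <;> intro h
  · exact (h_semidef.mp h.posSemidef).posDef_iff_isUnit.mpr (h_unit.mp h.isUnit)
  · exact (h_semidef.mpr h.posSemidef).posDef_iff_isUnit.mpr (h_unit.mpr h.isUnit)

theorem posDef_fromBlocks_iff₁₁ [Fintype ι] [DecidableEq ι] [Finite κ] {S : Matrix ι ι ℝ}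
    {L : Matrix ι κ ℝ} {D : Matrix κ κ ℝ} (hS : S.PosDef) :
    (fromBlocks S L Lᵀ D).PosDef ↔ (D - Lᵀ * S⁻¹ * L).PosDef := by
  have h := posDef_fromBlocks_iff₂₂ (S := D) (L := Lᵀ) hS
  rw [transpose_transpose] at h
  rw [← h, ← posDef_submatrix_equiv (Equiv.sumComm κ ι), Equiv.sumComm_apply,
    fromBlocks_submatrix_sum_swap_sum_swap]

theorem posDef_of_forall_mem_sphere [Fintype ι] {S : Matrix ι ι ℝ} (hS : S.IsSymm)
    (h : ∀ x ∈ Metric.sphere (0 : ι → ℝ) 1, 0 < x ⬝ᵥ S *ᵥ x) : S.PosDef := by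
  refine .of_dotProduct_mulVec_pos (isHermitian_iff_isSymm.mpr hS) fun x hx => ?_
  have h_norm : 0 < ‖x‖ := norm_pos_iff.mpr hx
  have h_unit : ‖x‖⁻¹ • x ∈ Metric.sphere (0 : ι → ℝ) 1 := by
    rw [mem_sphere_zero_iff_norm, norm_smul, norm_inv, norm_norm, inv_mul_cancel₀ h_norm.ne']
  have h_pos := h _ h_unit
  simp only [mulVec_smul, smul_dotProduct, dotProduct_smul, smul_eq_mul] at h_pos
  rw [star_trivial]
  by_contra! h_le
  have h_inv := inv_pos.mpr h_norm
  nlinarith [mul_nonneg h_inv.le (mul_nonneg h_inv.le (neg_nonneg.mpr h_le))]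

theorem eventually_posDef [Finite ι] {T : Type*} [TopologicalSpace T] {F : T → Matrix ι ι ℝ}
    (hF : Continuous F) (h_symm : ∀ t, (F t).IsSymm) {t₀ : T} (h : (F t₀).PosDef) :
    ∀ᶠ t in nhds t₀, (F t).PosDef := by
  let _ := Fintype.ofFinite ι
  have h_sphere : ∀ᶠ t in nhds t₀, ∀ x ∈ Metric.sphere (0 : ι → ℝ) 1, 0 < x ⬝ᵥ F t *ᵥ x := by
    refine (isCompact_sphere 0 1).eventually_forall_of_forall_eventually fun x hx => ?_
    have h_cont : Continuous fun z : T × (ι → ℝ) => z.2 ⬝ᵥ F z.1 *ᵥ z.2 :=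
      continuous_snd.dotProduct ((hF.comp continuous_fst).matrix_mulVec continuous_snd)
    have hx₀ : x ≠ 0 := ne_zero_of_mem_unit_sphere ⟨x, hx⟩
    exact h_cont.continuousAt.eventually (lt_mem_nhds (h.dotProduct_mulVec_pos hx₀))
  filter_upwards [h_sphere] with t ht using posDef_of_forall_mem_sphere (h_symm t) ht

end PosDef

section KernelBasis

variable {q n r : Type*} [Fintype n]

theorem isKerBasis_iff [Fintype r] {C : Matrix q n ℝ} {V : Matrix n r ℝ} :
    IsKerBasis C V ↔ Function.Injective V.mulVec ∧ ∀ x, C *ᵥ x = 0 ↔ ∃ y, V *ᵥ y = x := by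
  rw [IsKerBasis, mulVec_injective_iff, ← range_mulVecLin, SetLike.ext_iff]
  simp only [LinearMap.mem_range, LinearMap.mem_ker, mulVecLin_apply]
  exact and_congr_right fun _ => forall_congr' fun _ => Iff.comm

theorem IsKerBasis.injective_mulVec {C : Matrix q n ℝ} {V : Matrix n r ℝ} [Fintype r]
    (h : IsKerBasis C V) : Function.Injective V.mulVec := (isKerBasis_iff.mp h).1

theorem IsKerBasis.mul_eq_zero {C : Matrix q n ℝ} {V : Matrix n r ℝ} [Finite r]
    (h : IsKerBasis C V) : C * V = 0 := by
  classical
  let _ := Fintype.ofFinite r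
  refine ext_of_mulVec_single fun j => ?_
  rw [← mulVec_mulVec, zero_mulVec]
  exact ((isKerBasis_iff.mp h).2 _).mpr ⟨_, rfl⟩

theorem IsKerBasis.exists_mulVec_eq {C : Matrix q n ℝ} {V : Matrix n r ℝ} [Fintype r]
    (h : IsKerBasis C V) {x : n → ℝ} (hx : C *ᵥ x = 0) : ∃ y, V *ᵥ y = x :=
  ((isKerBasis_iff.mp h).2 x).mp hx

end KernelBasis

section Projection

variable {ι q α : Type*} [Fintype ι]

theorem exists_orthogonal_projection_ker [Fintype α] [DecidableEq α] {Φ : Matrix ι ι ℝ}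
    (hΦ : Φ.PosDef) {P : Matrix q ι ℝ} {N : Matrix ι α ℝ} (hP : IsKerBasis P N) :
    ∃ K : Matrix α ι ℝ, K * N = 1 ∧ (N * K)ᵀ * Φ = Φ * (N * K) := by
  have hG : (Nᵀ * Φ * N).PosDef := posDef_transpose_mul_mul_same hΦ hP.injective_mulVec
  obtain ⟨W, hW_symm, hW⟩ : ∃ W, Wᵀ = W ∧ W * (Nᵀ * Φ * N) = 1 :=
    ⟨(Nᵀ * Φ * N)⁻¹, (isSymm_of_posDef hG.inv).eq,
      nonsing_inv_mul _ ((isUnit_iff_isUnit_det _).mp hG.isUnit)⟩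
  refine ⟨W * (Nᵀ * Φ), by rw [Matrix.mul_assoc, hW], ?_⟩
  simp only [transpose_mul, transpose_transpose, (isSymm_of_posDef hΦ).eq, hW_symm,
    Matrix.mul_assoc]

theorem orthogonal_projection_split [DecidableEq ι] {Φ R e : Matrix ι ι ℝ}
    (hR : R.IsSymm) (he : e * e = e) (h_adjoint : eᵀ * Φ = Φ * e) :
    Φ - R + R * (1 - e) + (R * (1 - e))ᵀ =
      eᵀ * (Φ - R) * e + (1 - e)ᵀ * (Φ + R) * (1 - e) := by
  have h_orthogonal : eᵀ * Φ * e = Φ * e := by rw [h_adjoint, Matrix.mul_assoc, he]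
  rw [transpose_mul, transpose_sub, transpose_one, hR.eq]
  calc Φ - R + R * (1 - e) + (1 - eᵀ) * R = Φ + R - R * e - eᵀ * R := by noncomm_ring
    _ = Φ - Φ * e - eᵀ * Φ + eᵀ * Φ * e + eᵀ * Φ * e + R - R * e - eᵀ * R := by
      rw [h_orthogonal, h_adjoint]; abel
    _ = eᵀ * (Φ - R) * e + (1 - eᵀ) * (Φ + R) * (1 - e) := by noncomm_ring

end Projection

section Elimination

variable {ι q s : Type*} [Fintype q]

theorem exists_eq_mul_of_mulVec_eq_zero [Fintype ι] {P : Matrix q ι ℝ}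
    {S : Matrix s ι ℝ} (h : ∀ x, P *ᵥ x = 0 → S *ᵥ x = 0) : ∃ Θ : Matrix s q ℝ, S = Θ * P := by
  classical
  obtain ⟨σ, hσ⟩ := P.mulVecLin.rangeRestrict.exists_rightInverse_of_surjective
    P.mulVecLin.range_rangeRestrict
  obtain ⟨f, hf⟩ := LinearMap.exists_extend (S.mulVecLin ∘ₗ σ)
  refine ⟨LinearMap.toMatrix' f, toLin'.injective (LinearMap.ext fun x => ?_)⟩
  have h_ker : P *ᵥ (x - σ ⟨P *ᵥ x, x, rfl⟩) = 0 := by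
    have := congrArg Subtype.val (LinearMap.congr_fun hσ ⟨P *ᵥ x, x, rfl⟩)
    simpa [mulVec_sub, sub_eq_zero] using this.symm
  have h_f : f (P *ᵥ x) = S *ᵥ σ ⟨P *ᵥ x, x, rfl⟩ :=
    LinearMap.congr_fun hf ⟨P *ᵥ x, x, rfl⟩
  have := h _ h_ker
  rw [mulVec_sub, sub_eq_zero] at this
  simpa [toLin'_mul] using this.trans h_f.symm

theorem transpose_mul_self_isSymm [Fintype s] (Q : Matrix s ι ℝ) : (Qᵀ * Q).IsSymm := by
  rw [IsSymm, transpose_mul, transpose_transpose]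

theorem exists_posDef_add_smul [Fintype ι] [Fintype s] {Ψ : Matrix ι ι ℝ} (hΨ : Ψ.IsSymm)
    (Q : Matrix s ι ℝ) (h : ∀ x ≠ 0, Q *ᵥ x = 0 → 0 < x ⬝ᵥ Ψ *ᵥ x) :
    ∃ ρ : ℝ, 0 ≤ ρ ∧ (Ψ + ρ • (Qᵀ * Q)).PosDef := by
  have h_form (ρ : ℝ) (x : ι → ℝ) :
      x ⬝ᵥ (Ψ + ρ • (Qᵀ * Q)) *ᵥ x = x ⬝ᵥ Ψ *ᵥ x + ρ * (Q *ᵥ x ⬝ᵥ Q *ᵥ x) := by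
    rw [add_mulVec, smul_mulVec, dotProduct_add, dotProduct_smul, smul_eq_mul, ← mulVec_mulVec,
      dotProduct_mulVec x Qᵀ, vecMul_transpose]
  have h_nonneg (x : ι → ℝ) : 0 ≤ Q *ᵥ x ⬝ᵥ Q *ᵥ x := by
    simpa using dotProduct_star_self_nonneg (Q *ᵥ x)
  have h_cont (ρ : ℝ) : Continuous fun x : ι → ℝ => x ⬝ᵥ (Ψ + ρ • (Qᵀ * Q)) *ᵥ x :=
    continuous_id.dotProduct (continuous_const.matrix_mulVec continuous_id)
  obtain ⟨k, hk⟩ := (isCompact_sphere (0 : ι → ℝ) 1).elim_directed_cover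
    (fun k : ℕ => {x : ι → ℝ | 0 < x ⬝ᵥ (Ψ + (k : ℝ) • (Qᵀ * Q)) *ᵥ x})
    (fun k => isOpen_lt continuous_const (h_cont k))
    (fun x hx => by
      have hx₀ : x ≠ 0 := ne_zero_of_mem_unit_sphere ⟨x, hx⟩
      simp only [mem_iUnion, mem_ofPred_eq, h_form]
      by_cases hQ : Q *ᵥ x = 0
      · exact ⟨0, by simpa [hQ] using h x hx₀ hQ⟩
      · have hQ_pos : 0 < Q *ᵥ x ⬝ᵥ Q *ᵥ x :=
          lt_of_le_of_ne (h_nonneg x) fun h₀ => hQ (dotProduct_self_eq_zero.mp h₀.symm)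
        obtain ⟨k, hk⟩ := Archimedean.arch (1 - x ⬝ᵥ Ψ *ᵥ x) hQ_pos
        rw [nsmul_eq_mul] at hk
        exact ⟨k, by linarith⟩)
    (Monotone.directed_le fun i j hij x hx => by
      simp only [mem_ofPred_eq, h_form] at hx ⊢
      have hij' : (i : ℝ) ≤ j := by exact_mod_cast hij
      nlinarith [mul_le_mul_of_nonneg_right hij' (h_nonneg x)])
  exact ⟨k, k.cast_nonneg, posDef_of_forall_mem_sphere
    (hΨ.add ((transpose_mul_self_isSymm Q).smul (k : ℝ))) fun x hx => hk hx⟩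

/-- The symmetric matrix `Ψ + Qᵀ Θ P + (Qᵀ Θ P)ᵀ`, affine in the gain `Θ`. Both closed-loop matrix
inequalities assert that such a matrix is positive definite. -/
def gainForm [Fintype s] (Ψ : Matrix ι ι ℝ) (P : Matrix q ι ℝ) (Q : Matrix s ι ℝ)
    (Θ : Matrix s q ℝ) : Matrix ι ι ℝ :=
  Ψ + Qᵀ * Θ * P + (Qᵀ * Θ * P)ᵀ

variable [Fintype s] {Ψ : Matrix ι ι ℝ} {P : Matrix q ι ℝ} {Q : Matrix s ι ℝ} {Θ : Matrix s q ℝ}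

theorem isSymm_gainForm (hΨ : Ψ.IsSymm) : (gainForm Ψ P Q Θ).IsSymm := by
  rw [gainForm, add_assoc]
  exact hΨ.add (isSymm_add_transpose_self _)

variable {α β : Type*}

theorem transpose_mul_gainForm_mul_left [Fintype ι] {N : Matrix ι α ℝ} (hN : P * N = 0) :
    Nᵀ * gainForm Ψ P Q Θ * N = Nᵀ * Ψ * N := by
  have hN' : Nᵀ * Pᵀ = 0 := by rw [← transpose_mul, hN, transpose_zero]
  simp only [gainForm, transpose_mul, Matrix.mul_add, Matrix.add_mul, Matrix.mul_assoc, hN,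
    Matrix.mul_zero, add_zero]
  simp only [← Matrix.mul_assoc, hN', Matrix.zero_mul, add_zero]

theorem transpose_mul_gainForm_mul_right [Fintype ι] {M : Matrix ι β ℝ} (hM : Q * M = 0) :
    Mᵀ * gainForm Ψ P Q Θ * M = Mᵀ * Ψ * M := by
  have hM' : Mᵀ * Qᵀ = 0 := by rw [← transpose_mul, hM, transpose_zero]
  simp only [gainForm, transpose_mul, transpose_transpose, Matrix.mul_add, Matrix.add_mul,
    Matrix.mul_assoc, hM, Matrix.mul_zero, add_zero]
  simp only [← Matrix.mul_assoc, hM', Matrix.zero_mul, add_zero]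

theorem exists_posDef_gainForm_of_posDef_add_smul [Fintype ι] [Finite α] {N : Matrix ι α ℝ}
    (hP : IsKerBasis P N) (hN : (Nᵀ * Ψ * N).PosDef) {ρ : ℝ} (hρ : 0 ≤ ρ)
    (hΦ : (Ψ + ρ • (Qᵀ * Q)).PosDef) : ∃ Θ, (gainForm Ψ P Q Θ).PosDef := by
  classical
  let _ := Fintype.ofFinite α
  set R := ρ • (Qᵀ * Q) with hR
  -- With `e = N K` the `Φ`-orthogonal projection onto `ker P` and `R = ρ Qᵀ Q`, the gain realizes
  -- `R (1 - e)`: this keeps `Ψ` on `ker P` and turns it into `Φ + R` on the orthogonal complement.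
  obtain ⟨K, hKN, h_adjoint⟩ := exists_orthogonal_projection_ker hΦ hP
  obtain ⟨Θ, hΘ⟩ : ∃ Θ : Matrix s q ℝ, ρ • (Q * (1 - N * K)) = Θ * P := by
    have h_compl : (1 - N * K) * N = 0 := by
      rw [Matrix.sub_mul, Matrix.one_mul, Matrix.mul_assoc, hKN, Matrix.mul_one, sub_self]
    refine exists_eq_mul_of_mulVec_eq_zero fun x hx => ?_
    obtain ⟨y, rfl⟩ := hP.exists_mulVec_eq hx
    rw [mulVec_mulVec, Matrix.smul_mul, Matrix.mul_assoc, h_compl, Matrix.mul_zero, smul_zero,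
      zero_mulVec]
  have h_gain : Qᵀ * Θ * P = R * (1 - N * K) := by
    rw [Matrix.mul_assoc, ← hΘ, hR, Matrix.smul_mul, Matrix.mul_smul, Matrix.mul_assoc]
  have h_idempotent : N * K * (N * K) = N * K := by
    rw [Matrix.mul_assoc, ← Matrix.mul_assoc K, hKN, Matrix.one_mul]
  have h_split : gainForm Ψ P Q Θ =
      Kᵀ * (Nᵀ * Ψ * N) * K + (1 - N * K)ᵀ * (Ψ + R + R) * (1 - N * K) := by
    have h := orthogonal_projection_split ((transpose_mul_self_isSymm Q).smul ρ) h_idempotent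
      h_adjoint
    rw [← hR, add_sub_cancel_right, ← h_gain] at h
    rw [gainForm, h]
    simp only [transpose_mul, Matrix.mul_assoc]
  refine ⟨Θ, h_split ▸ posDef_add_transpose_mul_mul_same hN (hΦ.add_posSemidef ?_) ?_⟩
  · exact (posSemidef_conjTranspose_mul_self Q).smul hρ
  · intro x hKx hx
    rwa [sub_mulVec, one_mulVec, ← mulVec_mulVec, hKx, mulVec_zero, sub_zero] at hx

theorem exists_posDef_gainForm_iff [Fintype ι] [Finite α] [Finite β] (hΨ : Ψ.IsSymm)
    {N : Matrix ι α ℝ} {M : Matrix ι β ℝ} (hP : IsKerBasis P N) (hQ : IsKerBasis Q M) :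
    (∃ Θ, (gainForm Ψ P Q Θ).PosDef) ↔ (Nᵀ * Ψ * N).PosDef ∧ (Mᵀ * Ψ * M).PosDef := by
  let _ := Fintype.ofFinite α
  let _ := Fintype.ofFinite β
  constructor
  · rintro ⟨Θ, hΘ⟩
    rw [← transpose_mul_gainForm_mul_left (Q := Q) (Θ := Θ) hP.mul_eq_zero,
      ← transpose_mul_gainForm_mul_right (P := P) (Θ := Θ) hQ.mul_eq_zero]
    exact ⟨posDef_transpose_mul_mul_same hΘ hP.injective_mulVec,
      posDef_transpose_mul_mul_same hΘ hQ.injective_mulVec⟩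
  · rintro ⟨hN, hM⟩
    have h_ker (x : ι → ℝ) (hx : x ≠ 0) (hQx : Q *ᵥ x = 0) : 0 < x ⬝ᵥ Ψ *ᵥ x := by
      obtain ⟨y, rfl⟩ := hQ.exists_mulVec_eq hQx
      rw [← dotProduct_transpose_mul_mul_same_mulVec]
      exact hM.dotProduct_mulVec_pos fun hy => hx (by rw [hy, mulVec_zero])
    obtain ⟨ρ, hρ, hΦ⟩ := exists_posDef_add_smul hΨ Q h_ker
    exact exists_posDef_gainForm_of_posDef_add_smul hP hN hρ hΦ

theorem convex_setOf_posDef_gainForm (Ψ : Matrix ι ι ℝ) (P : Matrix q ι ℝ) (Q : Matrix s ι ℝ) :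
    Convex ℝ {Θ | (gainForm Ψ P Q Θ).PosDef} := by
  refine convex_iff_forall_pos.mpr fun Θ₁ h₁ Θ₂ h₂ a b ha hb hab => ?_
  have h_affine : gainForm Ψ P Q (a • Θ₁ + b • Θ₂) =
      a • gainForm Ψ P Q Θ₁ + b • gainForm Ψ P Q Θ₂ := by
    have hΨ : Ψ = a • Ψ + b • Ψ := by rw [← add_smul, hab, one_smul]
    simp only [gainForm, Matrix.mul_add, Matrix.add_mul, Matrix.mul_smul, Matrix.smul_mul,
      transpose_add, transpose_smul, smul_add]
    nth_rewrite 1 [hΨ]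
    abel
  rw [mem_ofPred_eq, h_affine]
  exact (PosDef.smul h₁ ha).add (PosDef.smul h₂ hb)

theorem exists_continuous_posDef_gainForm [Finite ι] {T : Type*} [TopologicalSpace T]
    [NormalSpace T] [ParacompactSpace T] {Ψ : T → Matrix ι ι ℝ} {P : T → Matrix q ι ℝ}
    {Q : T → Matrix s ι ℝ} (hΨ_cont : Continuous Ψ) (hP : Continuous P) (hQ : Continuous Q)
    (hΨ : ∀ t, (Ψ t).IsSymm)
    (h : ∀ t, ∃ Θ, (gainForm (Ψ t) (P t) (Q t) Θ).PosDef) :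
    ∃ Θ : C(T, Matrix s q ℝ), ∀ t, (gainForm (Ψ t) (P t) (Q t) (Θ t)).PosDef := by
  refine exists_continuous_forall_mem_convex_of_local_const
    (fun t => convex_setOf_posDef_gainForm (Ψ t) (P t) (Q t)) fun t₀ => ?_
  obtain ⟨Θ, hΘ⟩ := h t₀
  have h_term : Continuous fun t => (Q t)ᵀ * Θ * P t :=
    (hQ.matrix_transpose.matrix_mul continuous_const).matrix_mul hP
  exact ⟨Θ, eventually_posDef ((hΨ_cont.add h_term).add h_term.matrix_transpose)
    (fun t => isSymm_gainForm (hΨ t)) hΘ⟩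

theorem exists_continuousOn_Icc_posDef_gainForm [Finite ι] {a b : ℝ} (hab : a ≤ b)
    {Ψ : ℝ → Matrix ι ι ℝ} {P : ℝ → Matrix q ι ℝ} {Q : ℝ → Matrix s ι ℝ}
    (hΨ_cont : ContinuousOn Ψ (Icc a b)) (hP : ContinuousOn P (Icc a b))
    (hQ : ContinuousOn Q (Icc a b)) (hΨ : ∀ t ∈ Icc a b, (Ψ t).IsSymm)
    (h : ∀ t ∈ Icc a b, ∃ Θ, (gainForm (Ψ t) (P t) (Q t) Θ).PosDef) :
    ∃ Θ : ℝ → Matrix s q ℝ, Continuous Θ ∧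
      ∀ t ∈ Icc a b, (gainForm (Ψ t) (P t) (Q t) (Θ t)).PosDef := by
  obtain ⟨Θ, hΘ⟩ := exists_continuous_posDef_gainForm hΨ_cont.domRestrict hP.domRestrict
    hQ.domRestrict (fun t => hΨ t t.2) (fun t => h t t.2)
  refine ⟨IccExtend hab Θ, Θ.continuous.Icc_extend', fun t ht => ?_⟩
  rw [IccExtend_of_mem hab _ ht]
  exact hΘ ⟨t, ht⟩

end Elimination

section BlockKernelBasis

variable {q r s α β : Type*} {n : Type*} [Fintype n] {C : Matrix q n ℝ} {V : Matrix n r ℝ}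

theorem isKerBasis_zero_one [DecidableEq n] : IsKerBasis (0 : Matrix q n ℝ) (1 : Matrix n n ℝ) := by
  simp [isKerBasis_iff, Function.Injective]

theorem IsKerBasis.neg [Finite r] (h : IsKerBasis C V) : IsKerBasis (-C) V := by
  let _ := Fintype.ofFinite r
  simpa only [isKerBasis_iff, neg_mulVec, neg_eq_zero] using isKerBasis_iff.mp h

theorem IsKerBasis.mul_inv [Finite r] [DecidableEq n] (h : IsKerBasis C V) {Z : Matrix n n ℝ}
    (hZ : IsUnit Z) : IsKerBasis (C * Z) (Z⁻¹ * V) := by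
  let _ := Fintype.ofFinite r
  have h_det := (isUnit_iff_isUnit_det _).mp hZ
  refine isKerBasis_iff.mpr ⟨fun x y hxy => ?_, fun x => ?_⟩
  · simp only [← mulVec_mulVec] at hxy
    exact h.injective_mulVec (mulVec_injective_of_isUnit ((isUnit_nonsing_inv_iff).mpr hZ) hxy)
  · rw [← mulVec_mulVec, (isKerBasis_iff.mp h).2]
    refine exists_congr fun y => ?_
    rw [← mulVec_mulVec]
    constructor <;> intro hy
    · rw [hy, mulVec_mulVec, nonsing_inv_mul _ h_det, one_mulVec]
    · rw [← hy, mulVec_mulVec, mul_nonsing_inv _ h_det, one_mulVec]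

theorem exists_eq_sumElim (x : r ⊕ α → ℝ) : ∃ y z, x = Sum.elim y z :=
  ⟨_, _, (Sum.elim_comp_inl_inr x).symm⟩

theorem IsKerBasis.fromBlocks_one [Finite r] [Fintype α] [DecidableEq α] (h : IsKerBasis C V) :
    IsKerBasis (fromBlocks C 0 0 (1 : Matrix α α ℝ)) (fromRows V 0) := by
  let _ := Fintype.ofFinite r
  refine isKerBasis_iff.mpr ⟨fun x y hxy => h.injective_mulVec ?_, fun x => ?_⟩
  · simpa [fromRows_mulVec, Sum.elim_eq_iff] using hxy
  · obtain ⟨x₁, x₂, rfl⟩ := exists_eq_sumElim x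
    simp [fromBlocks_mulVec, fromRows_mulVec, ← Sum.elim_zero_zero, Sum.elim_eq_iff,
      (isKerBasis_iff.mp h).2, eq_comm]

theorem IsKerBasis.fromCols_zero_right [Finite r] [Fintype α] [DecidableEq α]
    (h : IsKerBasis C V) :
    IsKerBasis (fromCols C (0 : Matrix q α ℝ)) (fromBlocks V 0 0 (1 : Matrix α α ℝ)) := by
  let _ := Fintype.ofFinite r
  refine isKerBasis_iff.mpr ⟨fun x y hxy => ?_, fun x => ?_⟩
  · obtain ⟨x₁, x₂, rfl⟩ := exists_eq_sumElim x
    obtain ⟨y₁, y₂, rfl⟩ := exists_eq_sumElim y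
    simpa [fromBlocks_mulVec, Sum.elim_eq_iff, h.injective_mulVec.eq_iff] using hxy
  · obtain ⟨x₁, x₂, rfl⟩ := exists_eq_sumElim x
    simp only [fromBlocks_mulVec, fromCols_mulVec, Sum.elim_comp_inl, Sum.elim_comp_inr,
      zero_mulVec, one_mulVec, add_zero, zero_add, Sum.elim_eq_iff, (isKerBasis_iff.mp h).2]
    exact ⟨fun ⟨y, hy⟩ => ⟨Sum.elim y x₂, by simpa⟩, fun ⟨y, hy, _⟩ => ⟨_, hy⟩⟩

theorem IsKerBasis.fromCols_zero_left [Finite r] [Fintype α] [DecidableEq α]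
    (h : IsKerBasis C V) :
    IsKerBasis (fromCols (0 : Matrix q α ℝ) C) (fromBlocks (1 : Matrix α α ℝ) 0 0 V) := by
  let _ := Fintype.ofFinite r
  refine isKerBasis_iff.mpr ⟨fun x y hxy => ?_, fun x => ?_⟩
  · obtain ⟨x₁, x₂, rfl⟩ := exists_eq_sumElim x
    obtain ⟨y₁, y₂, rfl⟩ := exists_eq_sumElim y
    simpa [fromBlocks_mulVec, Sum.elim_eq_iff, h.injective_mulVec.eq_iff] using hxy
  · obtain ⟨x₁, x₂, rfl⟩ := exists_eq_sumElim x
    simp only [fromBlocks_mulVec, fromCols_mulVec, Sum.elim_comp_inl, Sum.elim_comp_inr,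
      zero_mulVec, one_mulVec, add_zero, zero_add, Sum.elim_eq_iff, (isKerBasis_iff.mp h).2]
    exact ⟨fun ⟨y, hy⟩ => ⟨Sum.elim x₁ y, by simpa⟩, fun ⟨y, _, hy⟩ => ⟨_, hy⟩⟩

end BlockKernelBasis

section Forms

variable {ι : Type*} [Fintype ι] [DecidableEq ι]

theorem flowForm_eq (A X' X : Matrix ι ι ℝ) : flowForm A X' X = X' + Aᵀ * X + X * A := by
  simp [flowForm, transpose_fromRows, fromCols_mul_fromBlocks, fromCols_mul_fromRows]

theorem dualFlowForm_eq (A Y' Y : Matrix ι ι ℝ) :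
    dualFlowForm A Y' Y = Y' - A * Y - Y * Aᵀ := by
  simp [dualFlowForm, transpose_fromRows, fromCols_mul_fromBlocks, fromCols_mul_fromRows]
  abel

theorem jumpForm_eq (AJ X X₀ : Matrix ι ι ℝ) : jumpForm AJ X X₀ = AJᵀ * X₀ * AJ - X := by
  simp [jumpForm, transpose_fromRows, fromCols_mul_fromBlocks, fromCols_mul_fromRows]
  abel

theorem isSymm_flowForm {A X' X : Matrix ι ι ℝ} (hX' : X'.IsSymm) (hX : X.IsSymm) :
    (flowForm A X' X).IsSymm := by
  rw [IsSymm, flowForm_eq]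
  simp only [transpose_add, transpose_mul, transpose_transpose, hX.eq, hX'.eq]
  abel

theorem inv_mul_flowForm_mul_inv {A Z' Z : Matrix ι ι ℝ} (hZ : IsUnit Z) :
    Z⁻¹ * -flowForm A Z' Z * Z⁻¹ = dualFlowForm A (-(Z⁻¹ * Z' * Z⁻¹)) Z⁻¹ := by
  have h_det := (isUnit_iff_isUnit_det _).mp hZ
  simp only [flowForm_eq, dualFlowForm_eq, Matrix.mul_add, Matrix.add_mul, Matrix.mul_neg,
    Matrix.neg_mul, Matrix.mul_assoc, mul_nonsing_inv _ h_det, Matrix.mul_one,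
    nonsing_inv_mul_cancel_left _ _ h_det]
  abel

theorem negDef_jumpForm_iff {AJ X X₀ : Matrix ι ι ℝ} (hX₀ : X₀.PosDef) :
    NegDef (jumpForm AJ X X₀) ↔ (fromBlocks X AJᵀ AJ X₀⁻¹).PosDef := by
  have h_det := (isUnit_iff_isUnit_det _).mp hX₀.isUnit
  have h := posDef_fromBlocks_iff₂₂ (S := X) (L := AJᵀ) hX₀.inv
  rw [nonsing_inv_nonsing_inv _ h_det, transpose_transpose] at h
  rw [h, NegDef, jumpForm_eq, neg_sub]

end Forms

section ClosedLoopElimination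

theorem fromBlocks_add_mul_mul_eq_gainForm {ι κ q s : Type*} [Fintype q] [Fintype s]
    (S : Matrix ι ι ℝ) (A : Matrix κ ι ℝ) (R : Matrix κ κ ℝ) (B : Matrix κ s ℝ)
    (C : Matrix q ι ℝ) (Θ : Matrix s q ℝ) :
    fromBlocks S (A + B * Θ * C)ᵀ (A + B * Θ * C) R =
      gainForm (fromBlocks S Aᵀ A R) (fromCols C 0) (fromCols 0 Bᵀ) Θ := by
  have h : (fromCols (0 : Matrix s ι ℝ) Bᵀ)ᵀ * Θ * fromCols C (0 : Matrix q κ ℝ) =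
      fromBlocks 0 0 (B * Θ * C) 0 := by
    ext (i | i) (j | j) <;> simp [transpose_fromCols, fromRows_mul, mul_fromCols]
  simp [gainForm, h, fromBlocks_transpose, fromBlocks_add]

theorem transpose_fromBlocks_mul_fromBlocks_mul {ι κ α β : Type*} [Fintype ι] [Fintype κ]
    (V : Matrix ι α ℝ) (W : Matrix κ β ℝ) (S : Matrix ι ι ℝ) (L : Matrix ι κ ℝ)
    (M : Matrix κ ι ℝ) (D : Matrix κ κ ℝ) :
    (fromBlocks V 0 0 W)ᵀ * fromBlocks S L M D * fromBlocks V 0 0 W =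
      fromBlocks (Vᵀ * S * V) (Vᵀ * L * W) (Wᵀ * M * V) (Wᵀ * D * W) := by
  simp [fromBlocks_transpose, fromBlocks_multiply]

variable {ι q s α β : Type*} [Fintype ι] [DecidableEq ι] [Fintype q] [Fintype s]
  {A Z Z' Z₀ : Matrix ι ι ℝ} {B : Matrix ι s ℝ} {C : Matrix q ι ℝ} {V : Matrix ι α ℝ}
  {U : Matrix ι β ℝ}

theorem neg_flowForm_add_mul_mul (hZ : Z.IsSymm) (Θ : Matrix s q ℝ) :
    -flowForm (A + B * Θ * C) Z' Z = gainForm (-flowForm A Z' Z) (-C) (Bᵀ * Z) Θ := by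
  simp only [flowForm_eq, gainForm, transpose_add, transpose_mul, transpose_neg,
    transpose_transpose, hZ.eq, Matrix.mul_add, Matrix.add_mul, Matrix.mul_neg, Matrix.mul_assoc]
  abel

theorem exists_negDef_flowForm_iff [Finite α] [Finite β] (hZ : Z.PosDef) (hZ' : Z'.IsSymm)
    (hV : IsKerBasis C V) (hU : IsKerBasis Bᵀ U) :
    (∃ Θ : Matrix s q ℝ, NegDef (flowForm (A + B * Θ * C) Z' Z)) ↔
      NegDef (Vᵀ * flowForm A Z' Z * V) ∧
        (Uᵀ * dualFlowForm A (-(Z⁻¹ * Z' * Z⁻¹)) Z⁻¹ * U).PosDef := by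
  have hZ_symm := isSymm_of_posDef hZ
  simp only [NegDef, neg_flowForm_add_mul_mul hZ_symm]
  rw [exists_posDef_gainForm_iff (isSymm_flowForm hZ' hZ_symm).neg hV.neg
      (hU.mul_inv hZ.isUnit),
    ← inv_mul_flowForm_mul_inv hZ.isUnit, transpose_mul, (isSymm_of_posDef hZ.inv).eq]
  simp only [Matrix.mul_neg, Matrix.neg_mul, Matrix.mul_assoc]

theorem exists_negDef_jumpForm_iff [Finite α] [Finite β] (hZ : Z.PosDef) (hZ₀ : Z₀.PosDef)
    (hV : IsKerBasis C V) (hU : IsKerBasis Bᵀ U) :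
    (∃ Θ : Matrix s q ℝ, NegDef (jumpForm (A + B * Θ * C) Z Z₀)) ↔
      NegDef (Vᵀ * jumpForm A Z Z₀ * V) ∧ (Uᵀ * (Z₀⁻¹ - A * Z⁻¹ * Aᵀ) * U).PosDef := by
  classical
  let _ := Fintype.ofFinite α
  let _ := Fintype.ofFinite β
  have h_symm : (fromBlocks Z Aᵀ A Z₀⁻¹).IsSymm :=
    (isSymm_of_posDef hZ).fromBlocks rfl (isSymm_of_posDef hZ₀.inv)
  simp only [negDef_jumpForm_iff hZ₀, fromBlocks_add_mul_mul_eq_gainForm]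
  rw [exists_posDef_gainForm_iff h_symm hV.fromCols_zero_right hU.fromCols_zero_left]
  simp only [transpose_fromBlocks_mul_fromBlocks_mul, transpose_one, Matrix.one_mul,
    Matrix.mul_one]
  have h_primal := posDef_fromBlocks_iff₂₂ (S := Vᵀ * Z * V) (L := Vᵀ * Aᵀ) hZ₀.inv
  have h_dual := posDef_fromBlocks_iff₁₁ (L := Aᵀ * U) (D := Uᵀ * Z₀⁻¹ * U) hZ
  simp only [transpose_mul, transpose_transpose] at h_primal h_dual
  rw [h_primal, h_dual, NegDef, ← Matrix.neg_mul, ← Matrix.mul_neg, jumpForm_eq, neg_sub,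
    nonsing_inv_nonsing_inv _ ((isUnit_iff_isUnit_det _).mp hZ₀.isUnit)]
  simp only [Matrix.mul_sub, Matrix.sub_mul, Matrix.mul_assoc]

end ClosedLoopElimination

section GainSelection

variable {ι q s : Type*} [Fintype ι] [DecidableEq ι] [Fintype q] [Fintype s] {a b : ℝ}
  {A : Matrix ι ι ℝ} {B : Matrix ι s ℝ} {C : Matrix q ι ℝ}

theorem exists_continuous_negDef_flowForm (hab : a ≤ b) {Z' Z : ℝ → Matrix ι ι ℝ}
    (hZ'_cont : ContinuousOn Z' (Icc a b)) (hZ_cont : ContinuousOn Z (Icc a b))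
    (hZ' : ∀ t ∈ Icc a b, (Z' t).IsSymm) (hZ : ∀ t ∈ Icc a b, (Z t).IsSymm)
    (h : ∀ t ∈ Icc a b, ∃ Θ : Matrix s q ℝ, NegDef (flowForm (A + B * Θ * C) (Z' t) (Z t))) :
    ∃ Θ : ℝ → Matrix s q ℝ, Continuous Θ ∧
      ∀ t ∈ Icc a b, NegDef (flowForm (A + B * Θ t * C) (Z' t) (Z t)) := by
  have h_gain (t) (ht : t ∈ Icc a b) (Θ : Matrix s q ℝ) :
      NegDef (flowForm (A + B * Θ * C) (Z' t) (Z t)) ↔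
        (gainForm (-flowForm A (Z' t) (Z t)) (-C) (Bᵀ * Z t) Θ).PosDef := by
    rw [NegDef, neg_flowForm_add_mul_mul (hZ t ht)]
  have h_cont : ContinuousOn (fun t => -flowForm A (Z' t) (Z t)) (Icc a b) := by
    simp only [flowForm_eq]
    fun_prop
  obtain ⟨Θ, hΘ_cont, hΘ⟩ := exists_continuousOn_Icc_posDef_gainForm hab h_cont
    continuousOn_const (by fun_prop : ContinuousOn (fun t => Bᵀ * Z t) (Icc a b))
    (fun t ht => (isSymm_flowForm (hZ' t ht) (hZ t ht)).neg)
    (fun t ht => (h t ht).imp fun Θ => (h_gain t ht Θ).mp)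
  exact ⟨Θ, hΘ_cont, fun t ht => (h_gain t ht _).mpr (hΘ t ht)⟩

theorem exists_continuous_negDef_jumpForm (hab : a ≤ b) {Z : ℝ → Matrix ι ι ℝ}
    {Z₀ : Matrix ι ι ℝ} (hZ_cont : ContinuousOn Z (Icc a b)) (hZ : ∀ t ∈ Icc a b, (Z t).IsSymm)
    (hZ₀ : Z₀.PosDef)
    (h : ∀ t ∈ Icc a b, ∃ Θ : Matrix s q ℝ, NegDef (jumpForm (A + B * Θ * C) (Z t) Z₀)) :
    ∃ Θ : ℝ → Matrix s q ℝ, Continuous Θ ∧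
      ∀ t ∈ Icc a b, NegDef (jumpForm (A + B * Θ t * C) (Z t) Z₀) := by
  simp only [negDef_jumpForm_iff hZ₀, fromBlocks_add_mul_mul_eq_gainForm] at h ⊢
  have h_cont : ContinuousOn (fun t => fromBlocks (Z t) Aᵀ A Z₀⁻¹) (Icc a b) := by
    fun_prop
  exact exists_continuousOn_Icc_posDef_gainForm hab h_cont continuousOn_const
    continuousOn_const
    (fun t ht => (hZ t ht).fromBlocks rfl (isSymm_of_posDef hZ₀.inv)) h

end GainSelection

section AugmentedElimination

/-- The system `(A, B, C)` augmented by the integrator `x_c' = v` with `v` as an input and `x_c`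
as an output, closed by the static gain `Θ`: dynamic feedback for `(A, B, C)` is static feedback
for the augmented system. -/
def augmentedLoop {ν m l c : Type*} [Fintype m] [Fintype l] [Fintype c] [DecidableEq c]
    (A : Matrix ν ν ℝ) (B : Matrix ν m ℝ) (C : Matrix l ν ℝ) (Θ : Matrix (m ⊕ c) (l ⊕ c) ℝ) :
    Matrix (ν ⊕ c) (ν ⊕ c) ℝ :=
  fromBlocks A 0 0 0 + fromBlocks B 0 0 (1 : Matrix c c ℝ) * Θ *
    fromBlocks C 0 0 (1 : Matrix c c ℝ)

variable {ν c : Type*} [Fintype ν] [Fintype c]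

theorem transpose_fromRows_zero_mul_mul {α : Type*} (V : Matrix ν α ℝ)
    (S : Matrix (ν ⊕ c) (ν ⊕ c) ℝ) :
    (fromRows V (0 : Matrix c α ℝ))ᵀ * S * fromRows V (0 : Matrix c α ℝ) =
      Vᵀ * S.toBlocks₁₁ * V := by
  rw [← fromBlocks_toBlocks S]
  simp [transpose_fromRows, fromCols_mul_fromBlocks, fromCols_mul_fromRows]

theorem toBlocks₁₁_sub_fromBlocks_mul_mul (A : Matrix ν ν ℝ)
    (Y₀ Y : Matrix (ν ⊕ c) (ν ⊕ c) ℝ) :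
    (Y₀ - fromBlocks A 0 0 0 * Y * (fromBlocks A 0 0 0)ᵀ).toBlocks₁₁ =
      Y₀.toBlocks₁₁ - A * Y.toBlocks₁₁ * Aᵀ := by
  rw [← fromBlocks_toBlocks Y₀, ← fromBlocks_toBlocks Y]
  simp [fromBlocks_transpose, fromBlocks_multiply, fromBlocks_add, fromBlocks_neg,
    sub_eq_add_neg]

variable [DecidableEq ν] [DecidableEq c]

theorem toBlocks₁₁_flowForm_fromBlocks (A : Matrix ν ν ℝ) (Z' Z : Matrix (ν ⊕ c) (ν ⊕ c) ℝ) :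
    (flowForm (fromBlocks A 0 0 0) Z' Z).toBlocks₁₁ =
      flowForm A Z'.toBlocks₁₁ Z.toBlocks₁₁ := by
  rw [← fromBlocks_toBlocks Z', ← fromBlocks_toBlocks Z]
  simp [flowForm_eq, fromBlocks_transpose, fromBlocks_multiply, fromBlocks_add]

theorem toBlocks₁₁_dualFlowForm_fromBlocks (A : Matrix ν ν ℝ)
    (Y' Y : Matrix (ν ⊕ c) (ν ⊕ c) ℝ) :
    (dualFlowForm (fromBlocks A 0 0 0) Y' Y).toBlocks₁₁ =
      dualFlowForm A Y'.toBlocks₁₁ Y.toBlocks₁₁ := by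
  rw [← fromBlocks_toBlocks Y', ← fromBlocks_toBlocks Y]
  simp [dualFlowForm_eq, fromBlocks_transpose, fromBlocks_multiply, fromBlocks_add,
    fromBlocks_neg, sub_eq_add_neg]

theorem toBlocks₁₁_jumpForm_fromBlocks (A : Matrix ν ν ℝ) (Z Z₀ : Matrix (ν ⊕ c) (ν ⊕ c) ℝ) :
    (jumpForm (fromBlocks A 0 0 0) Z Z₀).toBlocks₁₁ =
      jumpForm A Z.toBlocks₁₁ Z₀.toBlocks₁₁ := by
  rw [← fromBlocks_toBlocks Z₀, ← fromBlocks_toBlocks Z, jumpForm_eq]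
  simp [jumpForm_eq, fromBlocks_transpose, fromBlocks_multiply, fromBlocks_add,
    fromBlocks_neg, sub_eq_add_neg]

variable {m l r k : Type*} [Fintype m] [Fintype l] [Finite r] [Finite k]
  {A : Matrix ν ν ℝ} {B : Matrix ν m ℝ} {C : Matrix l ν ℝ} {V : Matrix ν r ℝ}
  {U : Matrix ν k ℝ} {Z' Z Z₀ : Matrix (ν ⊕ c) (ν ⊕ c) ℝ}

theorem exists_negDef_flowForm_augmentedLoop_iff (hZ : Z.PosDef) (hZ' : Z'.IsSymm)
    (hV : IsKerBasis C V) (hU : IsKerBasis Bᵀ U) :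
    (∃ Θ : Matrix (m ⊕ c) (l ⊕ c) ℝ, NegDef (flowForm (augmentedLoop A B C Θ) Z' Z)) ↔
      NegDef (Vᵀ * flowForm A Z'.toBlocks₁₁ Z.toBlocks₁₁ * V) ∧
        (Uᵀ * dualFlowForm A (-(Z⁻¹ * Z' * Z⁻¹)).toBlocks₁₁ Z⁻¹.toBlocks₁₁ * U).PosDef := by
  have hU' : IsKerBasis (fromBlocks B 0 0 (1 : Matrix c c ℝ))ᵀ (fromRows U 0) := by
    simpa [fromBlocks_transpose] using hU.fromBlocks_one (α := c)
  simp only [augmentedLoop]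
  rw [exists_negDef_flowForm_iff hZ hZ' hV.fromBlocks_one hU', transpose_fromRows_zero_mul_mul,
    transpose_fromRows_zero_mul_mul, toBlocks₁₁_flowForm_fromBlocks,
    toBlocks₁₁_dualFlowForm_fromBlocks]

theorem exists_negDef_jumpForm_augmentedLoop_iff (hZ : Z.PosDef) (hZ₀ : Z₀.PosDef)
    (hV : IsKerBasis C V) (hU : IsKerBasis Bᵀ U) :
    (∃ Θ : Matrix (m ⊕ c) (l ⊕ c) ℝ, NegDef (jumpForm (augmentedLoop A B C Θ) Z Z₀)) ↔
      NegDef (Vᵀ * jumpForm A Z.toBlocks₁₁ Z₀.toBlocks₁₁ * V) ∧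
        (Uᵀ * (Z₀⁻¹.toBlocks₁₁ - A * Z⁻¹.toBlocks₁₁ * Aᵀ) * U).PosDef := by
  have hU' : IsKerBasis (fromBlocks B 0 0 (1 : Matrix c c ℝ))ᵀ (fromRows U 0) := by
    simpa [fromBlocks_transpose] using hU.fromBlocks_one (α := c)
  simp only [augmentedLoop]
  rw [exists_negDef_jumpForm_iff hZ hZ₀ hV.fromBlocks_one hU', transpose_fromRows_zero_mul_mul,
    transpose_fromRows_zero_mul_mul, toBlocks₁₁_jumpForm_fromBlocks,
    toBlocks₁₁_sub_fromBlocks_mul_mul]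

end AugmentedElimination

section ControllerGains

variable {n m l mJ lJ c : Type*}

/-- The controller whose flow and jump system matrices are the `2 × 2` block matrices `Θ τ` and
`ΘJ τ`, arranged as `[[D, C], [B, A]]` so that the plant channels come first. -/
def Controller.ofGains (Θ : ℝ → Matrix (m ⊕ c) (l ⊕ c) ℝ) (ΘJ : ℝ → Matrix (mJ ⊕ c) (lJ ⊕ c) ℝ) :
    Controller c m l mJ lJ where
  A τ := (Θ τ).toBlocks₂₂
  B τ := (Θ τ).toBlocks₂₁
  C τ := (Θ τ).toBlocks₁₂
  D τ := (Θ τ).toBlocks₁₁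
  AJ τ := (ΘJ τ).toBlocks₂₂
  BJ τ := (ΘJ τ).toBlocks₂₁
  CJ τ := (ΘJ τ).toBlocks₁₂
  DJ τ := (ΘJ τ).toBlocks₁₁

theorem Controller.isContinuous_ofGains (Tmin Tmax : ℝ) {Θ : ℝ → Matrix (m ⊕ c) (l ⊕ c) ℝ}
    {ΘJ : ℝ → Matrix (mJ ⊕ c) (lJ ⊕ c) ℝ} (hΘ : Continuous Θ) (hΘJ : Continuous ΘJ) :
    (Controller.ofGains Θ ΘJ).IsContinuous Tmin Tmax where
  A := (hΘ.matrix_submatrix Sum.inr Sum.inr).continuousOn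
  B := (hΘ.matrix_submatrix Sum.inr Sum.inl).continuousOn
  C := (hΘ.matrix_submatrix Sum.inl Sum.inr).continuousOn
  D := (hΘ.matrix_submatrix Sum.inl Sum.inl).continuousOn
  AJ := (hΘJ.matrix_submatrix Sum.inr Sum.inr).continuousOn
  BJ := (hΘJ.matrix_submatrix Sum.inr Sum.inl).continuousOn
  CJ := (hΘJ.matrix_submatrix Sum.inl Sum.inr).continuousOn
  DJ := (hΘJ.matrix_submatrix Sum.inl Sum.inl).continuousOn

variable [Fintype c] [DecidableEq c]

theorem augmentedLoop_fromBlocks [Fintype m] [Fintype l] (A : Matrix n n ℝ) (B : Matrix n m ℝ)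
    (C : Matrix l n ℝ) (D : Matrix m l ℝ) (Cc : Matrix m c ℝ) (Bc : Matrix c l ℝ)
    (Ac : Matrix c c ℝ) :
    augmentedLoop A B C (fromBlocks D Cc Bc Ac) =
      fromBlocks (A + B * D * C) (B * Cc) (Bc * C) Ac := by
  simp [augmentedLoop, fromBlocks_multiply, fromBlocks_add]

variable (P : Plant n m l mJ lJ)

theorem clFlow_eq_augmentedLoop [Fintype m] [Fintype l] (K : Controller c m l mJ lJ) (τ : ℝ) :
    clFlow P K τ =
      augmentedLoop P.A P.B P.C (fromBlocks (K.D τ) (K.C τ) (K.B τ) (K.A τ)) := by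
  rw [augmentedLoop_fromBlocks, clFlow]

theorem clJump_eq_augmentedLoop [Fintype mJ] [Fintype lJ] (K : Controller c m l mJ lJ) (τ : ℝ) :
    clJump P K τ =
      augmentedLoop P.AJ P.BJ P.CJ (fromBlocks (K.DJ τ) (K.CJ τ) (K.BJ τ) (K.AJ τ)) := by
  rw [augmentedLoop_fromBlocks, clJump]

variable (Θ : ℝ → Matrix (m ⊕ c) (l ⊕ c) ℝ) (ΘJ : ℝ → Matrix (mJ ⊕ c) (lJ ⊕ c) ℝ)

theorem clFlow_ofGains [Fintype m] [Fintype l] (τ : ℝ) :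
    clFlow P (.ofGains Θ ΘJ) τ = augmentedLoop P.A P.B P.C (Θ τ) := by
  rw [clFlow_eq_augmentedLoop]
  exact congrArg _ (fromBlocks_toBlocks _)

theorem clJump_ofGains [Fintype mJ] [Fintype lJ] (τ : ℝ) :
    clJump P (.ofGains Θ ΘJ) τ = augmentedLoop P.AJ P.BJ P.CJ (ΘJ τ) := by
  rw [clJump_eq_augmentedLoop]
  exact congrArg _ (fromBlocks_toBlocks _)

end ControllerGains

section Calculus

open scoped Matrix.Norms.Operator

variable {ι : Type*} {T τ : ℝ} {s : Set ℝ} {X Y W : ℝ → Matrix ι ι ℝ} {X' : Matrix ι ι ℝ}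

theorem hasDerivWithinAt_matrix [Finite ι] :
    HasDerivWithinAt X X' s τ ↔ ∀ i j, HasDerivWithinAt (fun t => X t i j) (X' i j) s τ := by
  let _ := Fintype.ofFinite ι
  exact hasDerivWithinAt_pi.trans (forall_congr' fun _ => hasDerivWithinAt_pi)

theorem contDiffOn_matrix [Fintype ι] {k : WithTop ℕ∞} :
    ContDiffOn ℝ k X s ↔ ∀ i j, ContDiffOn ℝ k (fun t => X t i j) s := by
  classical
  refine ⟨fun h i j => ?_, fun h => ?_⟩
  · exact (entryLinearMap ℝ ℝ i j).toContinuousLinearMap.contDiff.comp_contDiffOn h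
  · have h_sum : X = fun t => ∑ i, ∑ j, X t i j • single i j (1 : ℝ) := by
      ext1 t
      simpa only [smul_single, smul_eq_mul, mul_one] using matrix_eq_sum_single (X t)
    rw [h_sum]
    exact .sum fun i _ => .sum fun j _ => (h i j).smul contDiffOn_const

theorem hasDerivWithinAt_matrix_inv [Fintype ι] [DecidableEq ι] (h : HasDerivWithinAt X X' s τ)
    (hX : IsUnit (X τ)) :
    HasDerivWithinAt (fun t => (X t)⁻¹) (-((X τ)⁻¹ * X' * (X τ)⁻¹)) s τ := by
  obtain ⟨u, hu⟩ := hX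
  have h_inv := (hu ▸ hasFDerivAt_ringInverse (𝕜 := ℝ) u).comp_hasDerivWithinAt τ h
  have h_val : (-ContinuousLinearMap.mulLeftRight ℝ (Matrix ι ι ℝ) ↑u⁻¹ ↑u⁻¹) X' =
      -((X τ)⁻¹ * X' * (X τ)⁻¹) := by
    rw [← hu, ← coe_units_inv]
    simp
  have h_fun : (fun t => (X t)⁻¹) = Ring.inverse ∘ X :=
    funext fun t => nonsing_inv_eq_ringInverse (X t)
  rw [h_fun, ← h_val]
  exact h_inv

theorem contDiffOn_matrix_inv [Fintype ι] [DecidableEq ι] {k : WithTop ℕ∞}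
    (h : ContDiffOn ℝ k X s) (hX : ∀ t ∈ s, IsUnit (X t)) :
    ContDiffOn ℝ k (fun t => (X t)⁻¹) s := by
  intro t ht
  obtain ⟨u, hu⟩ := hX t ht
  simp only [nonsing_inv_eq_ringInverse]
  exact (hu ▸ contDiffAt_ringInverse ℝ u).comp_contDiffWithinAt t (h t ht)

theorem mderiv_eq [Finite ι] (hT : 0 < T) (hτ : τ ∈ Icc 0 T)
    (h : HasDerivWithinAt X X' (Icc 0 T) τ) : mderiv T X τ = X' := by
  ext i j
  exact (hasDerivWithinAt_matrix.mp h i j).derivWithin (uniqueDiffOn_Icc hT τ hτ)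

theorem mderiv_congr (h : EqOn X Y (Icc 0 T)) (hτ : τ ∈ Icc 0 T) :
    mderiv T X τ = mderiv T Y τ := by
  ext i j
  exact derivWithin_congr (fun t ht => congr_fun₂ (h ht) i j) (congr_fun₂ (h hτ) i j)

theorem mderiv_smul (a : ℝ) : mderiv T (fun t => a • X t) τ = a • mderiv T X τ := by
  ext i j
  exact derivWithin_const_smul_field a _

namespace IsC1Sym

theorem hasDerivWithinAt_mderiv [Finite ι] (hX : IsC1Sym T X) (hτ : τ ∈ Icc 0 T) :
    HasDerivWithinAt X (mderiv T X τ) (Icc 0 T) τ :=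
  hasDerivWithinAt_matrix.mpr fun i j =>
    ((hX.2 i j).differentiableOn_one τ hτ).hasDerivWithinAt

theorem continuousOn (hX : IsC1Sym T X) : ContinuousOn X (Icc 0 T) :=
  continuousOn_pi.mpr fun i => continuousOn_pi.mpr fun j => (hX.2 i j).continuousOn

theorem continuousOn_mderiv (hX : IsC1Sym T X) (hT : 0 < T) :
    ContinuousOn (mderiv T X) (Icc 0 T) :=
  continuousOn_pi.mpr fun i => continuousOn_pi.mpr fun j =>
    (hX.2 i j).continuousOn_derivWithin (uniqueDiffOn_Icc hT) le_rfl

theorem isSymm_mderiv (hX : IsC1Sym T X) (hτ : τ ∈ Icc 0 T) : (mderiv T X τ).IsSymm :=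
  (mderiv_congr (fun _ ht => hX.1 _ ht) hτ : mderiv T (fun t => (X t)ᵀ) τ = mderiv T X τ)

theorem const_smul (hX : IsC1Sym T X) (a : ℝ) : IsC1Sym T fun t => a • X t :=
  ⟨fun t ht => (hX.1 t ht).smul a, fun i j => (hX.2 i j).const_smul a⟩

theorem sub (hX : IsC1Sym T X) (hY : IsC1Sym T Y) : IsC1Sym T fun t => X t - Y t :=
  ⟨fun t ht => (hX.1 t ht).sub (hY.1 t ht), fun i j => (hX.2 i j).sub (hY.2 i j)⟩

theorem submatrix {κ : Type*} (hX : IsC1Sym T X) (f : κ → ι) :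
    IsC1Sym T fun t => (X t).submatrix f f :=
  ⟨fun t ht => (hX.1 t ht).submatrix f, fun i j => hX.2 (f i) (f j)⟩

theorem fromBlocks (hX : IsC1Sym T X) (hY : IsC1Sym T Y) (hW : IsC1Sym T W) :
    IsC1Sym T fun t => fromBlocks (X t) (Y t) (Y t) (W t) :=
  ⟨fun t ht => (hX.1 t ht).fromBlocks (hY.1 t ht) (hW.1 t ht), fun i j => by
    rcases i with i | i <;> rcases j with j | j
    exacts [hX.2 i j, hY.2 i j, hY.2 i j, hW.2 i j]⟩

variable [Fintype ι] [DecidableEq ι]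

theorem inv (hX : IsC1Sym T X) (hX_unit : ∀ τ ∈ Icc 0 T, IsUnit (X τ)) :
    IsC1Sym T fun t => (X t)⁻¹ := by
  refine ⟨fun t ht => ?_, contDiffOn_matrix.mp ?_⟩
  · rw [IsSymm, transpose_nonsing_inv, (hX.1 t ht).eq]
  · exact contDiffOn_matrix_inv (contDiffOn_matrix.mpr hX.2) hX_unit

theorem mderiv_inv (hX : IsC1Sym T X) (hT : 0 < T) (hτ : τ ∈ Icc 0 T) (hX_unit : IsUnit (X τ)) :
    mderiv T (fun t => (X t)⁻¹) τ = -((X τ)⁻¹ * mderiv T X τ * (X τ)⁻¹) :=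
  mderiv_eq hT hτ (hasDerivWithinAt_matrix_inv (hX.hasDerivWithinAt_mderiv hτ) hX_unit)

end IsC1Sym

end Calculus

section ControllerElimination

variable {ν m l mJ lJ c r k rJ kJ : Type*} [Fintype ν] [DecidableEq ν] {Tmin Tmax : ℝ}

/-- The conditions left on the plant blocks `X` of a closed-loop certificate and `Y` of its inverse
once the controller is eliminated. The columns of `V`, `U`, `VJ`, `UJ` are meant to span the kernels
of `C`, `Bᵀ`, `C_J`, `B_Jᵀ`. -/
def SolvesProjectedLMIs (Tmin Tmax : ℝ) (P : Plant ν m l mJ lJ) (V : Matrix ν r ℝ)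
    (U : Matrix ν k ℝ) (VJ : Matrix ν rJ ℝ) (UJ : Matrix ν kJ ℝ) (X Y : ℝ → Matrix ν ν ℝ) : Prop :=
  (∀ τ ∈ Icc 0 Tmax,
    NegDef (Vᵀ * flowForm P.A (mderiv Tmax X τ) (X τ) * V) ∧
    (Uᵀ * dualFlowForm P.A (mderiv Tmax Y τ) (Y τ) * U).PosDef) ∧
  ∀ τ ∈ Icc Tmin Tmax,
    NegDef (VJᵀ * jumpForm P.AJ (X τ) (X 0) * VJ) ∧
    (UJᵀ * (Y 0 - P.AJ * Y τ * P.AJᵀ) * UJ).PosDef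

variable [Fintype m] [Fintype l] [Fintype mJ] [Fintype lJ] [Fintype c] [DecidableEq c]
  {P : Plant ν m l mJ lJ} {Z : ℝ → Matrix (ν ⊕ c) (ν ⊕ c) ℝ}

theorem exists_controller_isCertificate_iff_forall_exists (hTmin : 0 ≤ Tmin)
    (hT : Tmin ≤ Tmax) (hTmax : 0 < Tmax)
    (hZ : IsC1Sym Tmax Z) (hZ_pos : ∀ τ ∈ Icc 0 Tmax, (Z τ).PosDef) :
    (∃ K : Controller c m l mJ lJ, K.IsContinuous Tmin Tmax ∧
        IsCertificate Tmin Tmax (clFlow P K) (clJump P K) Z) ↔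
      (∀ τ ∈ Icc 0 Tmax, ∃ Θ : Matrix (m ⊕ c) (l ⊕ c) ℝ,
        NegDef (flowForm (augmentedLoop P.A P.B P.C Θ) (mderiv Tmax Z τ) (Z τ))) ∧
      ∀ τ ∈ Icc Tmin Tmax, ∃ Θ : Matrix (mJ ⊕ c) (lJ ⊕ c) ℝ,
        NegDef (jumpForm (augmentedLoop P.AJ P.BJ P.CJ Θ) (Z τ) (Z 0)) := by
  have h_subset : Icc Tmin Tmax ⊆ Icc 0 Tmax := Icc_subset_Icc_left hTmin
  constructor
  · rintro ⟨K, -, hK⟩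
    exact ⟨fun τ hτ => ⟨_, clFlow_eq_augmentedLoop P K τ ▸ hK.flow τ hτ⟩,
      fun τ hτ => ⟨_, clJump_eq_augmentedLoop P K τ ▸ hK.jump τ hτ⟩⟩
  · rintro ⟨h_flow, h_jump⟩
    obtain ⟨Θ, hΘ_cont, hΘ⟩ := exists_continuous_negDef_flowForm hTmax.le
      (hZ.continuousOn_mderiv hTmax) hZ.continuousOn (fun τ hτ => hZ.isSymm_mderiv hτ) hZ.1 h_flow
    obtain ⟨ΘJ, hΘJ_cont, hΘJ⟩ := exists_continuous_negDef_jumpForm hT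
      (hZ.continuousOn.mono h_subset) (fun τ hτ => hZ.1 τ (h_subset hτ))
      (hZ_pos 0 (left_mem_Icc.mpr hTmax.le)) h_jump
    refine ⟨.ofGains Θ ΘJ, Controller.isContinuous_ofGains Tmin Tmax hΘ_cont hΘJ_cont, hZ, hZ_pos,
      fun τ hτ => ?_, fun τ hτ => ?_⟩
    · rw [clFlow_ofGains]
      exact hΘ τ hτ
    · rw [clJump_ofGains]
      exact hΘJ τ hτ

theorem exists_controller_isCertificate_iff [Finite r] [Finite k] [Finite rJ] [Finite kJ]
    {V : Matrix ν r ℝ} {U : Matrix ν k ℝ} {VJ : Matrix ν rJ ℝ} {UJ : Matrix ν kJ ℝ}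
    (hV : IsKerBasis P.C V) (hU : IsKerBasis P.Bᵀ U) (hVJ : IsKerBasis P.CJ VJ)
    (hUJ : IsKerBasis P.BJᵀ UJ) (hTmin : 0 ≤ Tmin) (hT : Tmin ≤ Tmax) (hTmax : 0 < Tmax)
    {Y : ℝ → Matrix ν ν ℝ} (hZ : IsC1Sym Tmax Z) (hZ_pos : ∀ τ ∈ Icc 0 Tmax, (Z τ).PosDef)
    (hY : EqOn Y (fun τ => (Z τ)⁻¹.toBlocks₁₁) (Icc 0 Tmax)) :
    (∃ K : Controller c m l mJ lJ, K.IsContinuous Tmin Tmax ∧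
        IsCertificate Tmin Tmax (clFlow P K) (clJump P K) Z) ↔
      SolvesProjectedLMIs Tmin Tmax P V U VJ UJ (fun τ => (Z τ).toBlocks₁₁) Y := by
  have h_zero : (0 : ℝ) ∈ Icc 0 Tmax := left_mem_Icc.mpr hTmax.le
  have h_flow (τ) (hτ : τ ∈ Icc 0 Tmax) :
      (∃ Θ : Matrix (m ⊕ c) (l ⊕ c) ℝ,
        NegDef (flowForm (augmentedLoop P.A P.B P.C Θ) (mderiv Tmax Z τ) (Z τ))) ↔
      NegDef (Vᵀ * flowForm P.A (mderiv Tmax (fun τ => (Z τ).toBlocks₁₁) τ) (Z τ).toBlocks₁₁ * V) ∧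
        (Uᵀ * dualFlowForm P.A (mderiv Tmax Y τ) (Y τ) * U).PosDef := by
    have h_deriv : mderiv Tmax Y τ =
        (-((Z τ)⁻¹ * mderiv Tmax Z τ * (Z τ)⁻¹)).toBlocks₁₁ := by
      rw [mderiv_congr hY hτ, ← hZ.mderiv_inv hTmax hτ (hZ_pos τ hτ).isUnit]
      rfl
    rw [exists_negDef_flowForm_augmentedLoop_iff (hZ_pos τ hτ) (hZ.isSymm_mderiv hτ) hV hU,
      h_deriv, hY hτ]
    rfl
  have h_jump (τ) (hτ : τ ∈ Icc Tmin Tmax) :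
      (∃ Θ : Matrix (mJ ⊕ c) (lJ ⊕ c) ℝ,
        NegDef (jumpForm (augmentedLoop P.AJ P.BJ P.CJ Θ) (Z τ) (Z 0))) ↔
      NegDef (VJᵀ * jumpForm P.AJ (Z τ).toBlocks₁₁ (Z 0).toBlocks₁₁ * VJ) ∧
        (UJᵀ * (Y 0 - P.AJ * Y τ * P.AJᵀ) * UJ).PosDef := by
    have hτ' : τ ∈ Icc 0 Tmax := Icc_subset_Icc_left hTmin hτ
    rw [exists_negDef_jumpForm_augmentedLoop_iff (hZ_pos τ hτ') (hZ_pos 0 h_zero) hVJ hUJ,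
      hY hτ', hY h_zero]
  rw [exists_controller_isCertificate_iff_forall_exists hTmin hT hTmax hZ hZ_pos,
    forall₂_congr h_flow, forall₂_congr h_jump]
  rfl

end ControllerElimination

section Coupling

theorem SolvesProjectedLMIs.smul_left {ν m l mJ lJ r k rJ kJ : Type*} [Fintype ν] [DecidableEq ν]
    {Tmin Tmax : ℝ} {P : Plant ν m l mJ lJ} {V : Matrix ν r ℝ} {U : Matrix ν k ℝ}
    {VJ : Matrix ν rJ ℝ} {UJ : Matrix ν kJ ℝ} {X Y : ℝ → Matrix ν ν ℝ}
    (h : SolvesProjectedLMIs Tmin Tmax P V U VJ UJ X Y) {a : ℝ} (ha : 0 < a) :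
    SolvesProjectedLMIs Tmin Tmax P V U VJ UJ (fun τ => a • X τ) Y := by
  refine ⟨fun τ hτ => ⟨?_, (h.1 τ hτ).2⟩, fun τ hτ => ⟨?_, (h.2 τ hτ).2⟩⟩
  · have h_smul := PosDef.smul (h.1 τ hτ).1 ha
    simpa [NegDef, flowForm_eq, mderiv_smul, ← smul_add] using h_smul
  · have h_smul := PosDef.smul (h.2 τ hτ).1 ha
    simpa [NegDef, jumpForm_eq, ← smul_sub] using h_smul

theorem transpose_fromCols_mul_mul {ι α β : Type*} [Fintype ι] (F : Matrix ι α ℝ)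
    (G : Matrix ι β ℝ) (S : Matrix ι ι ℝ) :
    (fromCols F G)ᵀ * S * fromCols F G =
      fromBlocks (Fᵀ * S * F) (Fᵀ * S * G) (Gᵀ * S * F) (Gᵀ * S * G) := by
  rw [transpose_fromCols, fromRows_mul, fromRows_mul_fromCols]

variable {ν c : Type*} [Fintype ν] [DecidableEq ν]

theorem posDef_fromBlocks_inv_toBlocks₁₁ [Fintype c] [DecidableEq c]
    {Z : Matrix (ν ⊕ c) (ν ⊕ c) ℝ} (hZ : Z.PosDef) :
    (fromBlocks Z⁻¹.toBlocks₁₁ 1 1 ((2 : ℝ) • Z.toBlocks₁₁)).PosDef := by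
  have h_det := (isUnit_iff_isUnit_det _).mp hZ.isUnit
  let E : Matrix (ν ⊕ c) ν ℝ := fromRows 1 0
  let G : Matrix (ν ⊕ c) (ν ⊕ ν) ℝ := fromCols E (Z * E)
  let H : Matrix ν (ν ⊕ ν) ℝ := fromCols 0 1
  have h_corner (S : Matrix (ν ⊕ c) (ν ⊕ c) ℝ) : Eᵀ * S * E = S.toBlocks₁₁ := by
    rw [transpose_fromRows_zero_mul_mul, transpose_one, Matrix.one_mul, Matrix.mul_one]
  have hG : Gᵀ * Z⁻¹ * G = fromBlocks Z⁻¹.toBlocks₁₁ 1 1 Z.toBlocks₁₁ := by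
    have hE : Eᵀ * E = 1 := by simp [E, transpose_fromRows, fromCols_mul_fromRows]
    rw [← h_corner, ← h_corner, ← hE, transpose_fromCols_mul_mul]
    simp only [transpose_mul, (isSymm_of_posDef hZ).eq, Matrix.mul_assoc,
      mul_nonsing_inv_cancel_left _ _ h_det, nonsing_inv_mul_cancel_left _ _ h_det]
  have hH : Hᵀ * Z.toBlocks₁₁ * H = fromBlocks 0 0 0 Z.toBlocks₁₁ := by
    rw [transpose_fromCols_mul_mul]
    simp
  -- `Gᵀ Z⁻¹ G` is singular when `c` is smaller than `ν`; doubling `X` makes the coupling strict.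
  have h_split : fromBlocks Z⁻¹.toBlocks₁₁ 1 1 ((2 : ℝ) • Z.toBlocks₁₁) =
      Gᵀ * Z⁻¹ * G + Hᵀ * Z.toBlocks₁₁ * H := by
    simp [hG, hH, fromBlocks_add, two_smul]
  rw [h_split]
  refine posDef_add_transpose_mul_mul_same hZ.inv (hZ.submatrix Sum.inl_injective) ?_
  intro x hGx hHx
  obtain ⟨x₁, x₂, rfl⟩ := exists_eq_sumElim x
  obtain rfl : x₂ = 0 := by simpa [H] using hHx
  obtain rfl : x₁ = 0 := by
    simpa [G, E, fromRows_mulVec, ← Sum.elim_zero_zero, Sum.elim_eq_iff] using hGx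
  exact Sum.elim_zero_zero

/-- A Lyapunov matrix for the closed loop of order `|ν|` with upper left block `X` whose inverse has
upper left block `Y`. -/
noncomputable def lyapunovExtension (X Y : Matrix ν ν ℝ) : Matrix (ν ⊕ ν) (ν ⊕ ν) ℝ :=
  fromBlocks X (X - Y⁻¹) (X - Y⁻¹) (X - Y⁻¹)

variable {X Y : Matrix ν ν ℝ}

theorem posDef_sub_inv_of_posDef_fromBlocks (hY : Y.PosDef) (h : (fromBlocks Y 1 1 X).PosDef) :
    (X - Y⁻¹).PosDef := by
  have h_schur := posDef_fromBlocks_iff₁₁ (L := 1) (D := X) hY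
  simp only [transpose_one, Matrix.one_mul, Matrix.mul_one] at h_schur
  exact h_schur.mp h

theorem posDef_lyapunovExtension (hY : Y.PosDef) (hW : (X - Y⁻¹).PosDef) :
    (lyapunovExtension X Y).PosDef := by
  let G : Matrix ν (ν ⊕ ν) ℝ := fromCols 1 0
  let H : Matrix ν (ν ⊕ ν) ℝ := fromCols 1 1
  have h_split : lyapunovExtension X Y = Gᵀ * Y⁻¹ * G + Hᵀ * (X - Y⁻¹) * H := by
    rw [transpose_fromCols_mul_mul, transpose_fromCols_mul_mul]
    simp [lyapunovExtension, fromBlocks_add]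
  rw [h_split]
  refine posDef_add_transpose_mul_mul_same hY.inv hW fun x hGx hHx => ?_
  obtain ⟨x₁, x₂, rfl⟩ := exists_eq_sumElim x
  obtain rfl : x₁ = 0 := by simpa [G] using hGx
  obtain rfl : x₂ = 0 := by simpa [H] using hHx
  exact Sum.elim_zero_zero

theorem inv_lyapunovExtension_toBlocks₁₁ (hY : IsUnit Y) (hW : IsUnit (X - Y⁻¹)) :
    (lyapunovExtension X Y)⁻¹.toBlocks₁₁ = Y := by
  have hYY : Y⁻¹ * Y = 1 := nonsing_inv_mul _ ((isUnit_iff_isUnit_det _).mp hY)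
  have hWW := mul_nonsing_inv _ ((isUnit_iff_isUnit_det _).mp hW)
  have h_inv : lyapunovExtension X Y * fromBlocks Y (-Y) (-Y) (Y + (X - Y⁻¹)⁻¹) = 1 := by
    rw [lyapunovExtension, fromBlocks_multiply, ← fromBlocks_one]
    simp only [Matrix.mul_add, Matrix.mul_neg, hWW, Matrix.sub_mul, hYY]
    congr 1 <;> abel
  rw [inv_eq_right_inv h_inv, toBlocks_fromBlocks₁₁]

end Coupling

section SampledData

variable {n p : Type*} [Fintype n] [DecidableEq n] [Fintype p] [DecidableEq p]

variable {q : Type*} (m l : Type*) (A : Matrix n n ℝ) (B : Matrix n p ℝ) (CJ : Matrix q n ℝ)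

theorem isKerBasis_sampledDataPlant_B :
    IsKerBasis (sampledDataPlant m l A B CJ).Bᵀ (1 : Matrix (n ⊕ p) (n ⊕ p) ℝ) :=
  isKerBasis_zero_one

theorem isKerBasis_sampledDataPlant_BJ :
    IsKerBasis (sampledDataPlant m l A B CJ).BJᵀ (fromRows (1 : Matrix n n ℝ) 0) := by
  refine isKerBasis_iff.mpr ⟨fun x y hxy => ?_, fun x => ?_⟩
  · simpa [fromRows_mulVec, Sum.elim_eq_iff] using hxy
  · obtain ⟨x₁, x₂, rfl⟩ := exists_eq_sumElim x
    simp [sampledDataPlant, transpose_fromRows, fromRows_mulVec, Sum.elim_eq_iff, eq_comm]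

theorem solvesProjectedLMIs_sampledDataPlant_iff {r : Type*} {Tmin Tmax : ℝ}
    {VJ : Matrix n r ℝ} {X Y : ℝ → Matrix (n ⊕ p) (n ⊕ p) ℝ} :
    SolvesProjectedLMIs Tmin Tmax (sampledDataPlant m l A B CJ) (1 : Matrix (n ⊕ p) (n ⊕ p) ℝ)
        (1 : Matrix (n ⊕ p) (n ⊕ p) ℝ) (fromBlocks VJ 0 0 (1 : Matrix p p ℝ))
        (fromRows (1 : Matrix n n ℝ) 0) X Y ↔
      (∀ τ ∈ Icc 0 Tmax, NegDef (flowForm (hatA A B) (mderiv Tmax X τ) (X τ)) ∧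
        (dualFlowForm (hatA A B) (mderiv Tmax Y τ) (Y τ)).PosDef) ∧
      ∀ τ ∈ Icc Tmin Tmax,
        NegDef ((fromBlocks VJ 0 0 (1 : Matrix p p ℝ))ᵀ *
          (fromBlocks (X 0).toBlocks₁₁ 0 0 0 - X τ) * fromBlocks VJ 0 0 (1 : Matrix p p ℝ)) ∧
        ((Y 0).toBlocks₁₁ - (Y τ).toBlocks₁₁).PosDef := by
  have h_jump (S S₀ : Matrix (n ⊕ p) (n ⊕ p) ℝ) :
      jumpForm (fromBlocks 1 0 0 0) S S₀ = fromBlocks S₀.toBlocks₁₁ 0 0 0 - S := by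
    rw [jumpForm_eq, ← fromBlocks_toBlocks S₀]
    simp [fromBlocks_transpose, fromBlocks_multiply]
  have h_dual (S S₀ : Matrix (n ⊕ p) (n ⊕ p) ℝ) :
      (fromRows (1 : Matrix n n ℝ) (0 : Matrix p n ℝ))ᵀ *
        (S₀ - fromBlocks 1 0 0 0 * S * (fromBlocks 1 0 0 0)ᵀ) *
        fromRows (1 : Matrix n n ℝ) (0 : Matrix p n ℝ) = S₀.toBlocks₁₁ - S.toBlocks₁₁ := by
    rw [transpose_fromRows_zero_mul_mul, toBlocks₁₁_sub_fromBlocks_mul_mul]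
    simp
  simp only [SolvesProjectedLMIs, sampledDataPlant, transpose_one, Matrix.one_mul, Matrix.mul_one,
    h_jump, h_dual]

end SampledData

end ImpulsiveDesign

theorem corollary1_general {ν m l mJ lJ r k rJ kJ : Type*} [Fintype ν] [DecidableEq ν] [Fintype m]
    [Fintype l] [Fintype mJ] [Fintype lJ] [Finite r] [Finite k] [Finite rJ] [Finite kJ]
    {Tmin Tmax : ℝ} (hTmin : 0 ≤ Tmin) (hT : Tmin ≤ Tmax) (hTmax : 0 < Tmax)
    (P : Plant ν m l mJ lJ) {V : Matrix ν r ℝ} {U : Matrix ν k ℝ} {VJ : Matrix ν rJ ℝ}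
    {UJ : Matrix ν kJ ℝ} (hV : IsKerBasis P.C V) (hU : IsKerBasis P.Bᵀ U)
    (hVJ : IsKerBasis P.CJ VJ) (hUJ : IsKerBasis P.BJᵀ UJ) :
    ExistsCertifiedController Tmin Tmax P ↔ ∃ X Y : ℝ → Matrix ν ν ℝ,
      IsC1Sym Tmax X ∧ IsC1Sym Tmax Y ∧
      (∀ τ ∈ Icc 0 Tmax, (fromBlocks (Y τ) 1 1 (X τ)).PosDef) ∧
      SolvesProjectedLMIs Tmin Tmax P V U VJ UJ X Y := by
  constructor
  · rintro ⟨nc, K, hK_cont, Z, hK⟩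
    have h := (exists_controller_isCertificate_iff hV hU hVJ hUJ hTmin hT hTmax hK.c1 hK.pos
      fun _ _ => rfl).mp ⟨K, hK_cont, hK⟩
    exact ⟨_, _, (hK.c1.submatrix Sum.inl).const_smul 2,
      (hK.c1.inv fun τ hτ => (hK.pos τ hτ).isUnit).submatrix Sum.inl,
      fun τ hτ => posDef_fromBlocks_inv_toBlocks₁₁ (hK.pos τ hτ), h.smul_left two_pos⟩
  · rintro ⟨X, Y, hX, hY, hXY, h⟩
    have hY_pos (τ) (hτ : τ ∈ Icc 0 Tmax) : (Y τ).PosDef :=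
      (hXY τ hτ).submatrix Sum.inl_injective
    have hW_pos (τ) (hτ : τ ∈ Icc 0 Tmax) : (X τ - (Y τ)⁻¹).PosDef :=
      posDef_sub_inv_of_posDef_fromBlocks (hY_pos τ hτ) (hXY τ hτ)
    have hW : IsC1Sym Tmax fun τ => X τ - (Y τ)⁻¹ :=
      hX.sub (hY.inv fun τ hτ => (hY_pos τ hτ).isUnit)
    let e : ν ⊕ Fin (Fintype.card ν) ≃ ν ⊕ ν := .sumCongr (.refl ν) (Fintype.equivFin ν).symm
    let Z (τ : ℝ) := (lyapunovExtension (X τ) (Y τ)).submatrix e e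
    have hZ : IsC1Sym Tmax Z := (hX.fromBlocks hW hW).submatrix e
    have hZ_pos (τ) (hτ : τ ∈ Icc 0 Tmax) : (Z τ).PosDef :=
      (posDef_submatrix_equiv e).mpr (posDef_lyapunovExtension (hY_pos τ hτ) (hW_pos τ hτ))
    have hZ_inv (τ) (hτ : τ ∈ Icc 0 Tmax) : Y τ = (Z τ)⁻¹.toBlocks₁₁ := by
      rw [inv_submatrix_equiv]
      exact (inv_lyapunovExtension_toBlocks₁₁ (hY_pos τ hτ).isUnit (hW_pos τ hτ).isUnit).symm
    obtain ⟨K, hK_cont, hK⟩ := (exists_controller_isCertificate_iff hV hU hVJ hUJ hTmin hT hTmax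
      hZ hZ_pos hZ_inv).mpr h
    exact ⟨_, K, hK_cont, Z, hK⟩

theorem corollary1 (n p q r m l : ℕ) (Tmin Tmax : ℝ) (hTmin : 0 < Tmin) (hT : Tmin < Tmax)
    (A : Matrix (Fin n) (Fin n) ℝ) (B : Matrix (Fin n) (Fin p) ℝ) (CJ : Matrix (Fin q) (Fin n) ℝ)
    (VJ : Matrix (Fin n) (Fin r) ℝ) (hVJ : IsKerBasis CJ VJ) :
    ExistsCertifiedController Tmin Tmax
        (sampledDataPlant (Fin m) (Fin l) A B CJ) ↔
      ∃ X Y : ℝ → Matrix (Fin n ⊕ Fin p) (Fin n ⊕ Fin p) ℝ,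
        IsC1Sym Tmax X ∧ IsC1Sym Tmax Y ∧
        (∀ τ ∈ Icc 0 Tmax,
          (fromBlocks (Y τ) 1 1 (X τ)).PosDef ∧
          NegDef (flowForm (hatA A B)
            (mderiv Tmax X τ) (X τ)) ∧
          (dualFlowForm (hatA A B)
            (mderiv Tmax Y τ) (Y τ)).PosDef) ∧
        (∀ τ ∈ Icc Tmin Tmax,
          NegDef
            ((fromBlocks VJ 0 0 (1 : Matrix (Fin p) (Fin p) ℝ))ᵀ *
              (fromBlocks (X 0).toBlocks₁₁ 0 0 0 - X τ) *
              fromBlocks VJ 0 0 (1 : Matrix (Fin p) (Fin p) ℝ)) ∧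
          ((Y 0).toBlocks₁₁ - (Y τ).toBlocks₁₁).PosDef) := by
  rw [corollary1_general hTmin.le hT.le (hTmin.trans hT) _ isKerBasis_zero_one
    (isKerBasis_sampledDataPlant_B ..) hVJ.fromCols_zero_right (isKerBasis_sampledDataPlant_BJ ..)]
  simp only [solvesProjectedLMIs_sampledDataPlant_iff, imp_and, forall_and, and_assoc]
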